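/- Let $G$ be a smooth (possibly infinite-dimensional, Banach) Lie group with Lie algebra $\mathfrak g$, acting smoothly from the right on a smooth (Banach) manifold $M$, and let $\pi\colon P\to M$ be a smooth principal $\mathbb C^*$-bundle (equivalently, $P=L^+$ is the frame bundle of a complex line bundle $L$ on $M$) with a connection $1$-form $A$. No lift of the $G$-action to $P$ is assumed. For $\xi\in\mathfrak g$ let $\hat\xi$ be the fundamental vector field on $M$ and let $(\xi\cdot f)(x)=\frac{d}{dt}\big|_{t=0}f(x\exp(t\xi))$ for $f\in\mathrm{Map}(M,\mathbb C)=C^\infty(M,\mathbb C)$. Let $\widehat G$ be the group of pairs $(g,\varphi)$, where $g\in G$ and $\varphi$ is a $\mathbb C^*$-equivariant diffeomorphism of $P$ covering the action of $g$ on $M$; it acts on $P$ from the right, so that the product is $p\cdot(ab)=(p\cdot a)\cdot b$. The projection $\widehat G\to G$ has kernel $\mathrm{Map}(M,\mathbb C^*)$. Let $\sigma$ be a local section of $\widehat G\to G$ defined on an open neighbourhood of $1\in G$, with $\sigma(1)=1$, smooth in the sense that $(p,g)\mapsto p\cdot\sigma(g)$ is smooth. For $\xi\in\mathfrak g$ let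 $\widehat{d\sigma(\xi)}$ be the vector field on $P$ whose value at $p$ is the derivative of $g\mapsto p\cdot\sigma(g)$ at $1$ in the direction $\xi$. Then: 1. There is a unique $2$-form $F$ on $M$ with $\pi^*F=dA$ (the curvature). Put $\omega_G(\xi,\eta)=-F(\hat\xi,\hat\eta)$. 2. There is a unique linear map $b\colon\mathfrak g\to\mathrm{Map}(M,\mathbb C)$ with $b(\xi)(\pi(p))=A_p\big(\widehat{d\sigma(\xi)}_p\big)$ for all $p\in P$; that is, $b(\xi)=A(\widehat{d\sigma(\xi)})$ descends to a smooth function on $M$. 3. There is a unique bilinear map $\omega_A\colon\mathfrak g\times\mathfrak g\to\mathrm{Map}(M,\mathbb C)$ with $$\frac{\partial^2}{\partial s\,\partial t}\Big|_{s=t=0}\sigma(e^{t\xi})\,\sigma(e^{s\eta})\,\sigma(e^{-t\xi})\,\sigma(e^{-s\eta})=([\xi,\eta],\,\omega_A(\xi,\eta))$$ in the splitting $\mathrm{Lie}(\widehat G)=\mathfrak g\oplus\mathrm{Map}(M,\mathbb C)$ defined by $d\sigma$; that is, for every $p\in P$ the mixed derivative at $s=t=0$ of $p\cdot\sigma(e^{t\xi})\sigma(e^{s\eta})\sigma(e^{-t\xi})\sigma(e^{-s\eta})$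 exists and is $\widehat{d\sigma([\xi,\eta])}_p$ plus the vertical vector at $p$ generated by $\omega_A(\xi,\eta)(\pi(p))\in\mathbb C=\mathrm{Lie}(\mathbb C^*)$. 4. The maps $\omega_G$ and $\omega_A$ differ by the coboundary of $b$: for all $\xi,\eta\in\mathfrak g$, $$\omega_A(\xi,\eta)=\omega_G(\xi,\eta)+\xi\cdot b(\eta)-\eta\cdot b(\xi)-b([\xi,\eta]).$$ -/

import Mathlib

open scoped Manifold ContDiff Topology RightActions
open Set

/-! ### One-parameter subgroups of a Lie group -/

section OneParameter

variable {EG : Type*} [NormedAddCommGroup EG] [NormedSpace ℝ EG] [CompleteSpace EG]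
  {HG : Type*} [TopologicalSpace HG] {IG : ModelWithCorners ℝ EG HG} [IG.Boundaryless]
  {G : Type*} [TopologicalSpace G] [ChartedSpace HG G] [Group G] [LieGroup IG ∞ G] [T2Space G]

/-- Left translation preserves left-invariant vector fields. -/
theorem mfderiv_mul_left_mulInvariantVectorField {EG : Type*} [NormedAddCommGroup EG]
    [NormedSpace ℝ EG] {HG : Type*} [TopologicalSpace HG] {IG : ModelWithCorners ℝ EG HG}
    {G : Type*} [TopologicalSpace G] [ChartedSpace HG G] [Group G] [LieGroup IG ∞ G]
    (ξ : GroupLieAlgebra IG G) (h g : G) :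
    mfderiv IG IG (fun x : G => h * x) g (mulInvariantVectorField ξ g) =
      (mulInvariantVectorField ξ (h * g) : TangentSpace IG (h * g)) := by
  have hd : ∀ a b : G, MDifferentiableAt IG IG (fun x : G => a * x) b := fun a b =>
    (contMDiff_mul_left (I := IG) (n := ∞) (a := a)).contMDiffAt.mdifferentiableAt (by simp)
  have D : (fun x : G => h * g * x) = (fun x => h * x) ∘ fun x => g * x := by
    ext x; simp [mul_assoc]
  have key : mfderiv IG IG (fun x : G => h * g * x) 1 =
      (mfderiv IG IG (fun x : G => h * x) (g * 1)).comp (mfderiv IG IG (fun x : G => g * x) 1) := by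
    rw [D]; exact mfderiv_comp (I' := IG) 1 (hd _ _) (hd _ _)
  have : mulInvariantVectorField ξ (h * g) =
    (mfderiv IG IG (fun x : G => h * x) (g * 1)) (mfderiv IG IG (fun x : G => g * x) 1 ξ) :=
    DFunLike.congr_fun key ξ
  rw [this, mul_one]; rfl

/-- A left-invariant vector field on a Lie group has an integral curve through the identity that is
defined for all times. -/
theorem exists_oneParameterSubgroup (ξ : GroupLieAlgebra IG G) :
    ∃ c : ℝ → G, c 0 = 1 ∧
      IsMIntegralCurve c (fun g : G => (mulInvariantVectorField ξ g : TangentSpace IG g)) := by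
  have : LieGroup IG (minSmoothness ℝ 3) G :=
    LieGroup.of_le (n := ∞) (by simp only [minSmoothness_of_isRCLikeNormedField]; exact ENat.LEInfty.out)
  have : IsManifold IG ∞ G := inferInstance
  have hv : ContMDiff IG IG.tangent 1
      (fun g : G => (⟨g, mulInvariantVectorField ξ g⟩ : TangentBundle IG G)) :=
    (contMDiff_mulInvariantVectorField (I := IG) ξ).of_le
      (le_trans (by norm_num) le_minSmoothness)
  obtain ⟨γ, hγ0, hγ⟩ := exists_isMIntegralCurveAt_of_contMDiffAt_boundaryless (I := IG) 0
    (hv.contMDiffAt (x := (1 : G)))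
  obtain ⟨ε, hε, hγ⟩ := isMIntegralCurveAt_iff'.1 hγ
  refine exists_isMIntegralCurve_of_isMIntegralCurveOn hv hε (fun h => ?_) 1
  refine ⟨fun t => h * γ t, by simp [hγ0], fun t ht => ?_⟩
  have h1 := hγ t (by simpa [Real.ball_eq_Ioo] using ht)
  rw [Real.ball_eq_Ioo, zero_sub, zero_add] at h1
  have h2 : HasMFDerivAt IG IG (fun x : G => h * x) (γ t) (mfderiv IG IG (fun x => h * x) (γ t)) :=
    ((contMDiff_mul_left (I := IG) (n := ∞) (a := h)).contMDiffAt.mdifferentiableAt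
      (by simp)).hasMFDerivAt
  have h3 := h2.comp_hasMFDerivWithinAt t h1
  refine h3.congr_mfderiv ?_
  refine ContinuousLinearMap.ext fun r => ?_
  have h4 := (mfderiv IG IG (fun x : G => h * x) (γ t)).map_smul r (mulInvariantVectorField ξ (γ t))
  rw [mfderiv_mul_left_mulInvariantVectorField ξ h (γ t)] at h4
  exact h4

/-- The one-parameter subgroup `t ↦ exp (t ξ)` of `G`, i.e. the integral curve through `1` of the
left-invariant vector field determined by `ξ`. -/
noncomputable def expCurve (ξ : GroupLieAlgebra IG G) : ℝ → G :=
  Classical.choose (exists_oneParameterSubgroup ξ)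

end OneParameter

/-! ### Principal `ℂˣ`-bundles and connections -/

section Bundles

variable {EM : Type*} [NormedAddCommGroup EM] [NormedSpace ℝ EM]
  {HM : Type*} [TopologicalSpace HM] (I : ModelWithCorners ℝ EM HM)
  {M : Type*} [TopologicalSpace M] [ChartedSpace HM M]
  {EP : Type*} [NormedAddCommGroup EP] [NormedSpace ℝ EP]
  {HP : Type*} [TopologicalSpace HP] (J : ModelWithCorners ℝ EP HP)
  {P : Type*} [TopologicalSpace P] [ChartedSpace HP P]

/-- `π : P → M` is a smooth principal `ℂˣ`-bundle. As `ℂˣ` is commutative, its right action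
on `P` is written as a left action. -/
structure IsPrincipalCStarBundle [MulAction ℂˣ P] (π : P → M) : Prop where
  contMDiff_proj : ContMDiff J I ∞ π
  contMDiff_smul : ContMDiff (𝓘(ℝ, ℂ).prod J) J ∞ (fun q : ℂˣ × P => q.1 • q.2)
  proj_smul : ∀ (z : ℂˣ) (p : P), π (z • p) = π p
  /-- Every point of `M` has an open neighbourhood `U` with an equivariant diffeomorphism
  from `π ⁻¹ (U)` onto `U × ℂˣ` over `U`. -/
  locally_trivial : ∀ x : M, ∃ U : Set M, IsOpen U ∧ x ∈ U ∧
    ∃ e : OpenPartialHomeomorph P (M × ℂˣ),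
      e.source = π ⁻¹' U ∧ e.target = U ×ˢ univ ∧
      ContMDiffOn J (I.prod 𝓘(ℝ, ℂ)) ∞ e e.source ∧
      ContMDiffOn (I.prod 𝓘(ℝ, ℂ)) J ∞ e.symm e.target ∧
      (∀ p ∈ e.source, (e p).1 = π p) ∧
      ∀ p ∈ e.source, ∀ z : ℂˣ, (e (z • p)).2 = z * (e p).2

/-- The fundamental vertical vector field on `P` generated by `z ∈ ℂ = Lie(ℂˣ)`: the velocity at
`1` in direction `z` of the orbit map `lam ↦ lam • p`. -/
noncomputable def vertField [MulAction ℂˣ P] (z : ℂ) (p : P) : TangentSpace J p :=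
  mfderiv 𝓘(ℝ, ℂ) J (fun lam : ℂˣ => lam • p) 1 z

/-- A connection `1`-form on a principal `ℂˣ`-bundle with total space `P`: a smooth `ℂ`-valued
`1`-form on `P`, invariant under `ℂˣ` and reproducing the generators of the vertical fields. -/
structure ConnectionForm (P : Type*) [TopologicalSpace P] [ChartedSpace HP P] [IsManifold J 1 P]
    [MulAction ℂˣ P] where
  form : ∀ p : P, TangentSpace J p →L[ℝ] Bundle.Trivial P ℂ p
  contMDiff_form : ContMDiff J (J.prod 𝓘(ℝ, EP →L[ℝ] ℂ)) ∞
    (fun p => Bundle.TotalSpace.mk' (EP →L[ℝ] ℂ)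
      (E := fun p : P => TangentSpace J p →L[ℝ] Bundle.Trivial P ℂ p) p (form p))
  form_vertField : ∀ (z : ℂ) (p : P), form p (vertField J z p) = z
  form_smul : ∀ (lam : ℂˣ) (p : P) (v : TangentSpace J p),
    form (lam • p) (mfderiv J J (fun q : P => lam • q) p v) = form p v

/-- The exterior derivative at `p` of a `ℂ`-valued `1`-form `A` on `P`, computed in the preferred
chart at `p` (which identifies `TangentSpace J p` with the model space `EP`):
`dA (u, v) = ∂_u (A v) - ∂_v (A u)` for constant `u`, `v`. -/
noncomputable def extDerivOneForm (A : ∀ p : P, TangentSpace J p →L[ℝ] ℂ) (p : P)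
    (u v : TangentSpace J p) : ℂ :=
  let a : EP → EP →L[ℝ] ℂ := fun y =>
    (A ((extChartAt J p).symm y)).comp (mfderiv 𝓘(ℝ, EP) J (extChartAt J p).symm y)
  fderiv ℝ a (extChartAt J p p) u v - fderiv ℝ a (extChartAt J p p) v u

/-- `F` is the curvature of the connection form `A`: the `2`-form on `M` whose pullback to `P`
is `dA`. -/
def IsCurvature [IsManifold J 1 P] [MulAction ℂˣ P] (π : P → M) (A : ConnectionForm J P)
    (F : ∀ x : M, TangentSpace I x →L[ℝ] TangentSpace I x →L[ℝ] ℂ) : Prop :=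
  ∀ (p : P) (u v : TangentSpace J p),
    F (π p) (mfderiv J I π p u) (mfderiv J I π p v) = extDerivOneForm J A.form p u v

/-- For a family `(t, s) ↦ u t s` of points of `P` with `u 0 0 = p` whose first partial derivatives
at `(0, 0)` vanish, `v` is the tangent vector `∂²u/∂s∂t` at `s = t = 0`. It is read in the preferred
chart at `p`; as the first derivatives vanish, it does not depend on the chart. -/
def HasMixedDeriv (u : ℝ → ℝ → P) (p : P) (v : TangentSpace J p) : Prop :=
  ∃ w : ℝ → EP,
    (∀ᶠ s in 𝓝 (0 : ℝ), HasDerivAt (fun t => extChartAt J p (u t s)) (w s) 0) ∧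
    HasDerivAt w (v : EP) 0

end Bundles

/-! ### Infinitesimal action -/

section Action

variable {EG : Type*} [NormedAddCommGroup EG] [NormedSpace ℝ EG]
  {HG : Type*} [TopologicalSpace HG] {IG : ModelWithCorners ℝ EG HG}
  {G : Type*} [TopologicalSpace G] [ChartedSpace HG G] [Group G]
  {EM : Type*} [NormedAddCommGroup EM] [NormedSpace ℝ EM]
  {HM : Type*} [TopologicalSpace HM] (I : ModelWithCorners ℝ EM HM)
  {M : Type*} [TopologicalSpace M] [ChartedSpace HM M] [MulAction Gᵐᵒᵖ M]

/-- The fundamental vector field on `M` generated by `ξ ∈ Lie(G)`, for a right action of `G`: the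
velocity at `1` in direction `ξ` of the orbit map `g ↦ x g`. -/
noncomputable def fundField (ξ : GroupLieAlgebra IG G) (x : M) : TangentSpace I x :=
  (mfderiv IG I (fun g : G => x <• g) 1 ξ : EM)

/-- The action of `ξ ∈ Lie(G)` on functions: `(ξ · f)(x) = d/dt f(x exp(tξ))` at `t = 0`. -/
noncomputable def lieAct [CompleteSpace EG] [IG.Boundaryless] [LieGroup IG ∞ G] [T2Space G]
    (ξ : GroupLieAlgebra IG G) (f : M → ℂ) (x : M) : ℂ :=
  deriv (fun t : ℝ => f (x <• expCurve ξ t)) 0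

end Action

/-! ### The extension of `G` by bundle automorphisms -/

section Extension

variable {EG : Type*} [NormedAddCommGroup EG] [NormedSpace ℝ EG]
  {HG : Type*} [TopologicalSpace HG] (IG : ModelWithCorners ℝ EG HG)
  (G : Type*) [TopologicalSpace G] [ChartedSpace HG G] [Group G]
  {EM : Type*} [NormedAddCommGroup EM] [NormedSpace ℝ EM]
  {HM : Type*} [TopologicalSpace HM] (I : ModelWithCorners ℝ EM HM)
  {M : Type*} [TopologicalSpace M] [ChartedSpace HM M] [MulAction Gᵐᵒᵖ M]
  {EP : Type*} [NormedAddCommGroup EP] [NormedSpace ℝ EP]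
  {HP : Type*} [TopologicalSpace HP] (J : ModelWithCorners ℝ EP HP)
  {P : Type*} [TopologicalSpace P] [ChartedSpace HP P] [MulAction ℂˣ P]

/-- The group `Ĝ` of automorphisms of the principal `ℂˣ`-bundle `π : P → M` covering the right
action of `G` on `M`: pairs of `g ∈ G` and an equivariant diffeomorphism of `P` covering the
action of `g`. It acts on `P` from the right. -/
@[ext] structure CoveringAut (π : P → M) where
  base : G
  diffeo : P ≃ₘ^∞⟮J, J⟯ P
  equivariant : ∀ (z : ℂˣ) (p : P), diffeo (z • p) = z • diffeo p
  covers : ∀ p : P, π (diffeo p) = π p <• base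

namespace CoveringAut

variable {G J}
variable {π : P → M}

noncomputable instance : One (CoveringAut G J π) :=
  ⟨⟨1, Diffeomorph.refl J P ∞, fun _ _ => rfl, fun p => by simp⟩⟩

/-- The product `a b` acts on `P` by `p (a b) = (p a) b`. -/
noncomputable instance : Mul (CoveringAut G J π) :=
  ⟨fun a b => ⟨a.base * b.base, a.diffeo.trans b.diffeo,
    fun z p => by simp [a.equivariant, b.equivariant],
    fun p => by simp [a.covers, b.covers, mul_smul]⟩⟩

noncomputable instance : Inv (CoveringAut G J π) :=
  ⟨fun a => ⟨a.base⁻¹, a.diffeo.symm,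
    fun z p => a.diffeo.injective (by simp [a.equivariant]),
    fun p => by
      have h := a.covers (a.diffeo.symm p)
      rw [Diffeomorph.apply_symm_apply] at h
      rw [h, smul_smul, ← MulOpposite.op_mul]; simp⟩⟩

noncomputable instance : Group (CoveringAut G J π) where
  mul_assoc a b c := by
    ext1
    · exact mul_assoc _ _ _
    · rfl
  one_mul a := by
    ext1
    · exact one_mul _
    · rfl
  mul_one a := by
    ext1
    · exact mul_one _
    · rfl
  inv_mul_cancel a := by
    ext1
    · exact inv_mul_cancel _
    · exact Diffeomorph.ext fun p => a.diffeo.apply_symm_apply p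

end CoveringAut

/-- A smooth local section of `Ĝ → G`, defined on an open neighbourhood `dom` of `1` and with
`σ(1) = 1`. Smoothness means that `(p, g) ↦ p σ(g)` is smooth. Values outside `dom` play no
role. -/
structure LocalSection (π : P → M) where
  toFun : G → CoveringAut G J π
  dom : Set G
  isOpen_dom : IsOpen dom
  one_mem_dom : 1 ∈ dom
  base_toFun : ∀ g ∈ dom, (toFun g).base = g
  map_one : toFun 1 = 1
  contMDiffOn : ContMDiffOn (J.prod IG) J ∞ (fun q : P × G => (toFun q.2).diffeo q.1) (univ ×ˢ dom)

namespace LocalSection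

variable {IG G J}
variable {π : P → M}

/-- The fundamental vector field on `P` generated by `dσ(ξ) ∈ Lie(Ĝ)`: the velocity at `1` in
direction `ξ` of `g ↦ p σ(g)`. -/
noncomputable def field (σ : LocalSection IG G J π) (ξ : GroupLieAlgebra IG G) (p : P) :
    TangentSpace J p :=
  (mfderiv IG J (fun g : G => (σ.toFun g).diffeo p) 1 ξ : EP)

variable {I}

/-- `b` is the `1`-cochain `b(ξ) = A(fundamental vector field of dσ(ξ))`, a function on `P`
regarded as a function on `M`. -/
def IsConnectionCochain [IsManifold J 1 P] (σ : LocalSection IG G J π) (A : ConnectionForm J P)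
    (b : GroupLieAlgebra IG G →ₗ[ℝ] C^∞⟮I, M; 𝓘(ℝ, ℂ), ℂ⟯) : Prop :=
  ∀ (ξ : GroupLieAlgebra IG G) (p : P), b ξ (π p) = A.form p (σ.field ξ p)

/-- `om` is the `2`-cocycle defined by the local section `σ`:
`∂²/∂s∂t σ(exp tξ) σ(exp sη) σ(exp(-tξ)) σ(exp(-sη)) = ([ξ, η], om(ξ, η))` at `s = t = 0` in the
splitting `Lie(Ĝ) = Lie(G) ⊕ Map(M, ℂ)` given by `dσ`. Both sides are evaluated on `P`: an element
`(ζ, f)` of the right-hand side acts on `P` as the fundamental field of `dσ(ζ)` plus the vertical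
field which at `p` is generated by `f(π(p))`. -/
def IsSectionCocycle [CompleteSpace EG] [IG.Boundaryless] [LieGroup IG ∞ G] [T2Space G]
    (σ : LocalSection IG G J π)
    (om : GroupLieAlgebra IG G →ₗ[ℝ] GroupLieAlgebra IG G →ₗ[ℝ] C^∞⟮I, M; 𝓘(ℝ, ℂ), ℂ⟯) : Prop :=
  ∀ (ξ η : GroupLieAlgebra IG G) (p : P),
    HasMixedDeriv J
      (fun t s => (σ.toFun (expCurve ξ t) * σ.toFun (expCurve η s) *
        σ.toFun (expCurve ξ (-t)) * σ.toFun (expCurve η (-s))).diffeo p)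
      p (σ.field ⁅ξ, η⁆ p + vertField J (om ξ η (π p)) p)

end LocalSection

end Extension

/-! The section `σ` lets `G` act locally on `P` by `p ↦ p σ(g)`. This need not be multiplicative,
but it is smooth and trivial at `g = 1`. Let `V_ξ` be the field on `P` generated by `dσ(ξ)`. The
mixed derivative of `σ(e^{tξ}) σ(e^{sη}) σ(e^{-tξ}) σ(e^{-sη})` is the Lie bracket `[V_ξ, V_η]`.
This is `hasMixedDeriv_commutator`; it uses no multiplicativity, and the sign is plus because
factors of a right action are applied from left to right.

The field `V_ξ` is `π`-related to the fundamental field of `ξ` on `M`, where `G` really acts. Hence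
`[V_ξ, V_η]` and `V_{[ξ,η]}` both project to the fundamental field of `[ξ, η]`. Their difference is
vertical, and `A` reads off its generator as `A([V_ξ, V_η]) - b([ξ, η])`. By Cartan's formula
`A([V_ξ, V_η]) = V_ξ(A V_η) - V_η(A V_ξ) - dA(V_ξ, V_η)`. Since `A V_η = b(η) ∘ π` and `dA = π^*F`,
the generator is `-F + ξ·b(η) - η·b(ξ) - b([ξ, η])`, which is `hasMixedDeriv_curvature`. Defining
`ω_A` by this expression gives existence; uniqueness of mixed derivatives gives uniqueness and the
formula.

Descent to `M` rests on a local section `s`. In the coordinates `(ζ, y) ↦ e^ζ s(y)` the connection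
is `dζ + s^*A`, so `dA = d(s^*A)` involves only `y` and defines `F`. The function `A V_ξ` descends
because `A` and `V_ξ` are `ℂˣ`-invariant. -/

set_option linter.unusedSectionVars false

/-! ### Vector fields and Lie brackets in a chart -/

section Charts

open VectorField

variable {E : Type*} [NormedAddCommGroup E] [NormedSpace ℝ E]
  {H : Type*} [TopologicalSpace H] (I : ModelWithCorners ℝ E H)
  {N : Type*} [TopologicalSpace N] [ChartedSpace H N]
  {F : Type*} [NormedAddCommGroup F] [NormedSpace ℝ F]

/-- A vector field on a manifold, read in the preferred chart at `p`. -/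
noncomputable def vfChart (V : ∀ x : N, TangentSpace I x) (p : N) (y : E) : E :=
  mfderiv I 𝓘(ℝ, E) (extChartAt I p) ((extChartAt I p).symm y) (V ((extChartAt I p).symm y))

/-- A `1`-form on a manifold, read in the preferred chart at `p`. -/
noncomputable def formChart (A : ∀ x : N, TangentSpace I x →L[ℝ] F) (p : N) (y : E) : E →L[ℝ] F :=
  (A ((extChartAt I p).symm y)).comp (mfderiv 𝓘(ℝ, E) I (extChartAt I p).symm y)

variable {I} [I.Boundaryless] [IsManifold I ∞ N]

theorem eventually_mem_extChartAt_target (p : N) :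
    ∀ᶠ y in 𝓝 (extChartAt I p p), y ∈ (extChartAt I p).target :=
  extChartAt_target_mem_nhds p

theorem extChartAt_symm_self (p : N) : (extChartAt I p).symm (extChartAt I p p) = p :=
  extChartAt_to_inv p

theorem contMDiffAt_extChartAt_symm {p : N} {y : E} (hy : y ∈ (extChartAt I p).target) :
    ContMDiffAt 𝓘(ℝ, E) I ∞ (extChartAt I p).symm y :=
  (contMDiffOn_extChartAt_symm p).contMDiffAt ((isOpen_extChartAt_target p).mem_nhds hy)

theorem contMDiffAt_extChartAt_of_mem {p q : N} (hq : q ∈ (extChartAt I p).source) :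
    ContMDiffAt I 𝓘(ℝ, E) ∞ (extChartAt I p) q :=
  contMDiffAt_extChartAt' (by rwa [extChartAt_source] at hq)

theorem mdifferentiableAt_extChartAt_symm {p : N} {y : E} (hy : y ∈ (extChartAt I p).target) :
    MDifferentiableAt 𝓘(ℝ, E) I (extChartAt I p).symm y :=
  (contMDiffAt_extChartAt_symm hy).mdifferentiableAt (by simp)

theorem mfderiv_symm_mfderiv_extChartAt {p : N} {y : E} (hy : y ∈ (extChartAt I p).target)
    (v : TangentSpace I ((extChartAt I p).symm y)) :
    mfderiv 𝓘(ℝ, E) I (extChartAt I p).symm y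
      (mfderiv I 𝓘(ℝ, E) (extChartAt I p) ((extChartAt I p).symm y) v) = v := by
  have : IsManifold I 1 N := .of_le (n := ∞) (by simp)
  have h := mfderivWithin_extChartAt_symm_comp_mfderiv_extChartAt hy
  rw [I.range_eq_univ, mfderivWithin_univ] at h
  exact DFunLike.congr_fun h v

theorem mfderiv_extChartAt_self_apply (p : N) (v : TangentSpace I p) :
    mfderiv I 𝓘(ℝ, E) (extChartAt I p) p v = v := by
  have : IsManifold I 1 N := .of_le (n := ∞) (by simp)
  rw [mfderiv_extChartAt_self]; rfl

theorem mfderiv_extChartAt_symm_self_apply (p : N) (v : E) :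
    mfderiv 𝓘(ℝ, E) I (extChartAt I p).symm (extChartAt I p p) v = v := by
  have : IsManifold I 1 N := .of_le (n := ∞) (by simp)
  have h := mfderivWithin_range_extChartAt_symm (I := I) (x := p)
  rw [I.range_eq_univ, mfderivWithin_univ] at h
  rw [h]; rfl

theorem vfChart_self (V : ∀ x : N, TangentSpace I x) (p : N) :
    vfChart I V p (extChartAt I p p) = V p := by
  -- All tangent spaces are by definition `E`. Generalizing the base point to `q` allows
  -- substitution where rewriting inside the dependent type would not typecheck; the same device
  -- recurs below.
  have : ∀ q, q = p → mfderiv I 𝓘(ℝ, E) (extChartAt I p) q (V q) = (V p : E) := by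
    rintro q rfl; exact mfderiv_extChartAt_self_apply _ _
  exact this _ (extChartAt_symm_self p)

theorem formChart_vfChart (A : ∀ x : N, TangentSpace I x →L[ℝ] F) (V : ∀ x : N, TangentSpace I x)
    {p : N} {y : E} (hy : y ∈ (extChartAt I p).target) :
    formChart I A p y (vfChart I V p y) =
      A ((extChartAt I p).symm y) (V ((extChartAt I p).symm y)) := by
  unfold formChart vfChart
  exact congrArg (A ((extChartAt I p).symm y)) (mfderiv_symm_mfderiv_extChartAt hy _)

/-- The bracket on a manifold is the pullback of a bracket in the chart at `p`. The inner pullbacks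
invert the derivative of the inverse chart, hence apply the derivative of the chart. The outer one
is invisible, because the preferred chart has identity derivative at its own centre. -/
theorem mlieBracket_eq_chart (V W : ∀ x : N, TangentSpace I x) (p : N) :
    (mlieBracket I V W p : E) =
      fderiv ℝ (vfChart I W p) (extChartAt I p p) (V p) -
        fderiv ℝ (vfChart I V p) (extChartAt I p p) (W p) := by
  have : IsManifold I 1 N := .of_le (n := ∞) (by simp)
  have key : ∀ V : ∀ x : N, TangentSpace I x,
      mpullbackWithin 𝓘(ℝ, E) I (extChartAt I p).symm V (range I) =ᶠ[𝓝 (extChartAt I p p)]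
        vfChart I V p := by
    intro V
    filter_upwards [eventually_mem_extChartAt_target (I := I) p] with y hy
    rw [mpullbackWithin_apply, ContinuousLinearMap.inverse_eq
      (mfderivWithin_extChartAt_symm_comp_mfderiv_extChartAt hy)
      (mfderiv_extChartAt_comp_mfderivWithin_extChartAt_symm hy)]
    rfl
  have hid : ∀ v : E, (mfderiv I 𝓘(ℝ, E) (extChartAt I p) p).inverse v = v := by
    intro v
    have h : (mfderiv I 𝓘(ℝ, E) (extChartAt I p) p : E →L[ℝ] E) = .id ℝ E :=
      mfderiv_extChartAt_self
    refine (congrArg (fun L : E →L[ℝ] E => L.inverse v) h).trans ?_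
    simp only [ContinuousLinearMap.inverse_id]
    rfl
  rw [← mlieBracketWithin_univ, mlieBracketWithin_apply]
  refine (hid _).trans ?_
  have main : ∀ a b : E → E, a =ᶠ[𝓝 (extChartAt I p p)] vfChart I V p →
      b =ᶠ[𝓝 (extChartAt I p p)] vfChart I W p →
      lieBracketWithin ℝ a b ((extChartAt I p).symm ⁻¹' univ ∩ range I) (extChartAt I p p) =
        fderiv ℝ (vfChart I W p) (extChartAt I p p) (V p) -
          fderiv ℝ (vfChart I V p) (extChartAt I p p) (W p) := by
    intro a b ha hb
    rw [preimage_univ, univ_inter, I.range_eq_univ, lieBracketWithin_univ,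
      Filter.EventuallyEq.lieBracket_vectorField_eq ha hb, lieBracket, vfChart_self, vfChart_self]
  exact main _ _ (key V) (key W)

end Charts

/-! ### Smooth one-forms in a chart -/

section OneForms

variable {E : Type*} [NormedAddCommGroup E] [NormedSpace ℝ E]
  {H : Type*} [TopologicalSpace H] {I : ModelWithCorners ℝ E H} [I.Boundaryless]
  {N : Type*} [TopologicalSpace N] [ChartedSpace H N] [IsManifold I ∞ N]

theorem extDerivOneForm_eq_formChart (A : ∀ x : N, TangentSpace I x →L[ℝ] ℂ) (p : N)
    (u v : TangentSpace I p) :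
    extDerivOneForm I A p u v = fderiv ℝ (formChart I A p) (extChartAt I p p) u v -
      fderiv ℝ (formChart I A p) (extChartAt I p p) v u := rfl

/-- Smoothness of a `1`-form as a section of the bundle of linear forms, read in a chart. -/
theorem contDiffAt_formChart [IsManifold I 1 N] {A : ∀ p : N, TangentSpace I p →L[ℝ] Bundle.Trivial N ℂ p}
    (hA : ContMDiff I (I.prod 𝓘(ℝ, E →L[ℝ] ℂ)) ∞
      (fun p => Bundle.TotalSpace.mk' (E →L[ℝ] ℂ)
        (E := fun p : N => TangentSpace I p →L[ℝ] Bundle.Trivial N ℂ p) p (A p))) (p : N) :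
    ContDiffAt ℝ ∞ (formChart I (F := ℂ) A p) (extChartAt I p p) := by
  have h := ((contMDiffAt_hom_bundle _).1 (hA p)).2
  have h2 : ContMDiffAt 𝓘(ℝ, E) 𝓘(ℝ, E →L[ℝ] ℂ) ∞ _ (extChartAt I p p) :=
    ContMDiffAt.comp (extChartAt I p p) (g := fun x => ContinuousLinearMap.inCoordinates E
      (TangentSpace I) ℂ (Bundle.Trivial N ℂ) p x p x (A x)) (f := (extChartAt I p).symm)
      (by rw [extChartAt_symm_self]; exact h)
      (contMDiffAt_extChartAt_symm (mem_extChartAt_target p))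
  rw [contMDiffAt_iff_contDiffAt] at h2
  refine h2.congr_of_eventuallyEq ?_
  filter_upwards [eventually_mem_extChartAt_target (I := I) p] with y hy
  have hs : (extChartAt I p).symm y ∈ (chartAt H p).source := by
    rw [← extChartAt_source I]; exact (extChartAt I p).map_target hy
  ext v
  have h3 := TangentBundle.symmL_trivializationAt (I := I) hs
  -- The inverse of the tangent trivialization is the derivative of the inverse chart, and the
  -- trivial bundle contributes the identity; so `inCoordinates` is `formChart`.
  rw [(extChartAt I p).right_inv hy, I.range_eq_univ, mfderivWithin_univ] at h3
  have h4 : ∀ w : ℂ, (trivializationAt ℂ (Bundle.Trivial N ℂ) p).continuousLinearMapAt ℝ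
      ((extChartAt I p).symm y) w = w := fun w => by simp
  simp only [Function.comp_apply, ContinuousLinearMap.inCoordinates, h3]
  exact (h4 _).symm

end OneForms

/-! ### Symmetry and regularity of second derivatives -/

section SecondDerivative

variable {E F : Type*} [NormedAddCommGroup E] [NormedSpace ℝ E] [NormedAddCommGroup F]
  [NormedSpace ℝ F] {f : E → F} {x : E}

theorem ContDiffAt.fderiv_fderiv_symm (h : ContDiffAt ℝ ∞ f x) (v w : E) :
    fderiv ℝ (fderiv ℝ f) x v w = fderiv ℝ (fderiv ℝ f) x w v :=
  (h.isSymmSndFDerivAt (by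
    rw [minSmoothness_of_isRCLikeNormedField]; exact ENat.LEInfty.out)).eq v w

theorem ContDiffAt.contDiffAt_fderiv_infty (h : ContDiffAt ℝ ∞ f x) :
    ContDiffAt ℝ ∞ (fderiv ℝ f) x :=
  h.fderiv_right (m := ∞) (by simp)

theorem ContDiffAt.differentiableAt_fderiv (h : ContDiffAt ℝ ∞ f x) :
    DifferentiableAt ℝ (fderiv ℝ f) x :=
  h.contDiffAt_fderiv_infty.differentiableAt (by simp)

end SecondDerivative

/-! ### Naturality of the exterior derivative -/

section Pullback

variable {E : Type*} [NormedAddCommGroup E] [NormedSpace ℝ E]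
  {H : Type*} [TopologicalSpace H] {I : ModelWithCorners ℝ E H} [I.Boundaryless]
  {N : Type*} [TopologicalSpace N] [ChartedSpace H N] [IsManifold I ∞ N]
  {E' : Type*} [NormedAddCommGroup E'] [NormedSpace ℝ E']
  {F : Type*} [NormedAddCommGroup F] [NormedSpace ℝ F]

variable (I) in
/-- The pullback of a `1`-form to a normed space. -/
noncomputable def pullbackForm (A : ∀ x : N, TangentSpace I x →L[ℝ] F) (Φ : E' → N) (y : E') :
    E' →L[ℝ] F :=
  (A (Φ y)).comp (mfderiv 𝓘(ℝ, E') I Φ y)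

theorem pullbackForm_congr (A : ∀ x : N, TangentSpace I x →L[ℝ] F) {Φ Ψ : E' → N} {y : E'}
    (h : Φ =ᶠ[𝓝 y] Ψ) : pullbackForm I A Φ y = pullbackForm I A Ψ y := by
  have h1 := h.mfderiv_eq (I := 𝓘(ℝ, E')) (I' := I)
  have : ∀ (q q' : N) (L : E' →L[ℝ] E) (L' : E' →L[ℝ] E), q = q' → L = L' →
      (show E →L[ℝ] F from A q).comp L = (show E →L[ℝ] F from A q').comp L' := by
    rintro q q' L L' rfl rfl; rfl
  exact this _ _ _ _ h.self_of_nhds h1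

theorem ContMDiffAt.eventually_mdifferentiableAt {Φ : E' → N} {y₀ : E'}
    (h : ContMDiffAt 𝓘(ℝ, E') I ∞ Φ y₀) :
    ∀ᶠ y in 𝓝 y₀, MDifferentiableAt 𝓘(ℝ, E') I Φ y := by
  have : IsManifold I 1 N := .of_le (n := ∞) (by simp)
  have h1 : ContMDiffAt 𝓘(ℝ, E') I 1 Φ y₀ := h.of_le (by simp)
  filter_upwards [(contMDiffAt_iff_contMDiffAt_nhds (by simp)).1 h1] with y hy
  exact hy.mdifferentiableAt (by simp)

theorem contDiffAt_extChartAt_comp {Φ : E' → N} {y₀ : E'}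
    (h : ContMDiffAt 𝓘(ℝ, E') I ∞ Φ y₀) :
    ContDiffAt ℝ ∞ (fun y => extChartAt I (Φ y₀) (Φ y)) y₀ :=
  (ContMDiffAt.comp y₀ (contMDiffAt_extChartAt (I := I) (n := ∞) (x := Φ y₀)) h).contDiffAt

theorem mfderiv_eq_fderiv_extChartAt {Φ : E' → N} {y₀ : E'}
    (h : MDifferentiableAt 𝓘(ℝ, E') I Φ y₀) (v : E') :
    (mfderiv 𝓘(ℝ, E') I Φ y₀ v : E) = fderiv ℝ (fun y => extChartAt I (Φ y₀) (Φ y)) y₀ v := by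
  have hc : MDifferentiableAt I 𝓘(ℝ, E) (extChartAt I (Φ y₀)) (Φ y₀) :=
    (contMDiffAt_extChartAt (I := I) (n := ∞)).mdifferentiableAt (by simp)
  have h1 := mfderiv_comp y₀ hc h
  rw [mfderiv_eq_fderiv] at h1
  exact ((DFunLike.congr_fun h1 v).trans (mfderiv_extChartAt_self_apply _ _)).symm

/-- Near `y₀` the map `Φ` is the inverse chart composed with its own coordinate expression. The
chain rule then writes the pullback as a composition of maps between normed spaces, which can be
differentiated. -/
theorem pullbackForm_eventuallyEq (A : ∀ x : N, TangentSpace I x →L[ℝ] F) {Φ : E' → N} {y₀ : E'}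
    (h : ContMDiffAt 𝓘(ℝ, E') I ∞ Φ y₀) :
    pullbackForm I A Φ =ᶠ[𝓝 y₀] fun y =>
      (formChart I A (Φ y₀) (extChartAt I (Φ y₀) (Φ y))).comp
        (fderiv ℝ (fun y => extChartAt I (Φ y₀) (Φ y)) y) := by
  have hsrc : ∀ᶠ y in 𝓝 y₀, Φ y ∈ (extChartAt I (Φ y₀)).source :=
    h.continuousAt (extChartAt_source_mem_nhds _)
  filter_upwards [hsrc.eventually_nhds, h.eventually_mdifferentiableAt] with y hy hd
  have hy' := hy.self_of_nhds
  have e1 : Φ =ᶠ[𝓝 y] (extChartAt I (Φ y₀)).symm ∘ fun y => extChartAt I (Φ y₀) (Φ y) := by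
    filter_upwards [hy] with z hz
    exact ((extChartAt I (Φ y₀)).left_inv hz).symm
  have hd2 : MDifferentiableAt 𝓘(ℝ, E') 𝓘(ℝ, E) (fun y => extChartAt I (Φ y₀) (Φ y)) y :=
    ((contMDiffAt_extChartAt_of_mem hy').mdifferentiableAt (by simp)).comp y hd
  rw [pullbackForm_congr A e1, pullbackForm, mfderiv_comp y (mdifferentiableAt_extChartAt_symm
    ((extChartAt I (Φ y₀)).map_source hy')) hd2, mfderiv_eq_fderiv]
  rfl

/-- Pulling back a `1`-form to a normed space commutes with the exterior derivative. -/
theorem extDeriv_pullbackForm {A : ∀ x : N, TangentSpace I x →L[ℝ] ℂ} {Φ : E' → N} {y₀ : E'}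
    (h : ContMDiffAt 𝓘(ℝ, E') I ∞ Φ y₀)
    (hA : DifferentiableAt ℝ (formChart I A (Φ y₀)) (extChartAt I (Φ y₀) (Φ y₀))) :
    DifferentiableAt ℝ (pullbackForm I A Φ) y₀ ∧
    ∀ u v : E', fderiv ℝ (pullbackForm I A Φ) y₀ u v - fderiv ℝ (pullbackForm I A Φ) y₀ v u =
      extDerivOneForm I A (Φ y₀) (mfderiv 𝓘(ℝ, E') I Φ y₀ u) (mfderiv 𝓘(ℝ, E') I Φ y₀ v) := by
  have hφ := contDiffAt_extChartAt_comp h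
  have hev := pullbackForm_eventuallyEq A h
  have hsymm := hφ.fderiv_fderiv_symm
  have hdφ : DifferentiableAt ℝ (fun y => extChartAt I (Φ y₀) (Φ y)) y₀ :=
    hφ.differentiableAt (by simp)
  have hd2φ : DifferentiableAt ℝ (fderiv ℝ fun y => extChartAt I (Φ y₀) (Φ y)) y₀ := hφ.differentiableAt_fderiv
  -- With `a` the form and `φ` the map in coordinates, this differentiates `a(φ y) ∘ Dφ(y)`. The
  -- term containing `D²φ` is symmetric, so it disappears on antisymmetrizing.
  have hd := (HasFDerivAt.comp y₀ (f := fun y => extChartAt I (Φ y₀) (Φ y))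
    hA.hasFDerivAt hdφ.hasFDerivAt).clm_comp hd2φ.hasFDerivAt
  have hd' := hd.congr_of_eventuallyEq hev
  refine ⟨hd'.differentiableAt, fun u v => ?_⟩
  have hm := mfderiv_eq_fderiv_extChartAt (h.mdifferentiableAt (by simp))
  rw [hd'.fderiv, extDerivOneForm_eq_formChart]
  erw [hm u, hm v]
  simp only [add_apply, ContinuousLinearMap.comp_apply,
    ContinuousLinearMap.compL_apply, ContinuousLinearMap.flip_apply, hsymm u v]
  ring

end Pullback

/-! ### Cartan's formula and related vector fields -/

section Fields

open VectorField

variable {E : Type*} [NormedAddCommGroup E] [NormedSpace ℝ E]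
  {H : Type*} [TopologicalSpace H] {I : ModelWithCorners ℝ E H} [I.Boundaryless]
  {N : Type*} [TopologicalSpace N] [ChartedSpace H N] [IsManifold I ∞ N]
  {E' : Type*} [NormedAddCommGroup E'] [NormedSpace ℝ E']
  {H' : Type*} [TopologicalSpace H'] {I' : ModelWithCorners ℝ E' H'} [I'.Boundaryless]
  {N' : Type*} [TopologicalSpace N'] [ChartedSpace H' N'] [IsManifold I' ∞ N']

variable (I) in
/-- The derivative of a vector-valued function in the direction of a tangent vector. -/
noncomputable def dirDeriv {F : Type*} [NormedAddCommGroup F] [NormedSpace ℝ F] (f : N → F) (p : N)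
    (v : TangentSpace I p) : F :=
  mfderiv I 𝓘(ℝ, F) f p v

theorem dirDeriv_eq_fderiv {F : Type*} [NormedAddCommGroup F] [NormedSpace ℝ F]
    {f : N → F} {p : N} (hf : MDifferentiableAt I 𝓘(ℝ, F) f p) (v : E) :
    dirDeriv I f p v = fderiv ℝ (fun y => f ((extChartAt I p).symm y)) (extChartAt I p p) v := by
  have h1 := mfderiv_comp_of_eq (x := extChartAt I p p) (I := 𝓘(ℝ, E)) hf
    (mdifferentiableAt_extChartAt_symm (I := I) (mem_extChartAt_target p)) (extChartAt_symm_self p)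
  rw [mfderiv_eq_fderiv] at h1
  refine Eq.symm ((DFunLike.congr_fun h1 v).trans ?_)
  have h2 : ∀ q, q = p → ∀ w : E, (mfderiv I 𝓘(ℝ, F) f q w : F) = dirDeriv I f p w := by
    rintro q rfl w; rfl
  exact (h2 _ (extChartAt_symm_self p) _).trans
    (congrArg (dirDeriv I f p) (mfderiv_extChartAt_symm_self_apply (I := I) p v))

/-- Cartan's formula for the exterior derivative of a `1`-form. -/
theorem form_mlieBracket {A : ∀ x : N, TangentSpace I x →L[ℝ] ℂ} {p : N}
    (hA : DifferentiableAt ℝ (formChart I A p) (extChartAt I p p))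
    {V W : ∀ x : N, TangentSpace I x}
    (hV : DifferentiableAt ℝ (vfChart I V p) (extChartAt I p p))
    (hW : DifferentiableAt ℝ (vfChart I W p) (extChartAt I p p))
    (hAV : MDifferentiableAt I 𝓘(ℝ, ℂ) (fun x => A x (V x)) p)
    (hAW : MDifferentiableAt I 𝓘(ℝ, ℂ) (fun x => A x (W x)) p) :
    A p (mlieBracket I V W p) = dirDeriv I (fun x => A x (W x)) p (V p) -
      dirDeriv I (fun x => A x (V x)) p (W p) - extDerivOneForm I A p (V p) (W p) := by
  -- Product rule in the chart: `∂_v (A W) = (∂_v A) W + A (∂_v W)`. Antisymmetrizing in the two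
  -- fields, the first terms give `dA` and the second ones `A` of the bracket.
  have key : ∀ W : ∀ x : N, TangentSpace I x,
      DifferentiableAt ℝ (vfChart I W p) (extChartAt I p p) →
      MDifferentiableAt I 𝓘(ℝ, ℂ) (fun x => A x (W x)) p → ∀ v : E,
      dirDeriv I (fun x => A x (W x)) p v =
        fderiv ℝ (formChart I A p) (extChartAt I p p) v (W p) +
          A p (fderiv ℝ (vfChart I W p) (extChartAt I p p) v : E) := by
    intro W hW hAW v
    rw [dirDeriv_eq_fderiv hAW]
    have hev : (fun y => A ((extChartAt I p).symm y) (W ((extChartAt I p).symm y)))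
        =ᶠ[𝓝 (extChartAt I p p)] fun y => formChart I A p y (vfChart I W p y) := by
      filter_upwards [eventually_mem_extChartAt_target (I := I) p] with y hy
      exact (formChart_vfChart A W hy).symm
    rw [hev.fderiv_eq, (hA.hasFDerivAt.clm_apply hW.hasFDerivAt).fderiv]
    have h0 : ∀ w : E, formChart I A p (extChartAt I p p) w = A p w := by
      intro w
      have : ∀ q, q = p → ∀ w : E, A q w = A p w := by rintro q rfl w; rfl
      exact (this _ (extChartAt_symm_self p) _).trans
        (congrArg (A p) (mfderiv_extChartAt_symm_self_apply p w))
    rw [add_apply, ContinuousLinearMap.comp_apply, h0,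
      ContinuousLinearMap.flip_apply, vfChart_self, add_comm]
  have e1 := key W hW hAW (V p)
  have e2 := key V hV hAV (W p)
  have e3 := (A p).map_sub (fderiv ℝ (vfChart I W p) (extChartAt I p p) (V p) : E)
    (fderiv ℝ (vfChart I V p) (extChartAt I p p) (W p) : E)
  have e4 := congrArg (A p) (mlieBracket_eq_chart V W p)
  rw [extDerivOneForm_eq_formChart]
  refine e4.trans (e3.trans ?_)
  linear_combination -e1 + e2

/-- The Lie bracket of related vector fields is related. -/
theorem mfderiv_mlieBracket_of_related {f : N → N'} (hf : ContMDiff I I' ∞ f) (p : N)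
    {V W : ∀ x : N, TangentSpace I x} {V' W' : ∀ x : N', TangentSpace I' x}
    (hV : DifferentiableAt ℝ (vfChart I V p) (extChartAt I p p))
    (hW : DifferentiableAt ℝ (vfChart I W p) (extChartAt I p p))
    (hV' : DifferentiableAt ℝ (vfChart I' V' (f p)) (extChartAt I' (f p) (f p)))
    (hW' : DifferentiableAt ℝ (vfChart I' W' (f p)) (extChartAt I' (f p) (f p)))
    (relV : ∀ q, mfderiv I I' f q (V q) = V' (f q))
    (relW : ∀ q, mfderiv I I' f q (W q) = W' (f q)) :
    mfderiv I I' f p (mlieBracket I V W p) = mlieBracket I' V' W' (f p) := by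
  set g : E → E' := fun y => extChartAt I' (f p) (f ((extChartAt I p).symm y)) with hg
  have hd : ∀ q, MDifferentiableAt I I' f q := fun q => (hf q).mdifferentiableAt (by simp)
  have hfp : extChartAt I' (f p) (f ((extChartAt I p).symm (extChartAt I p p))) =
    extChartAt I' (f p) (f p) := by rw [extChartAt_symm_self]
  have hsm : ContMDiffAt 𝓘(ℝ, E) I' ∞ (fun y => f ((extChartAt I p).symm y)) (extChartAt I p p) :=
    (hf _).comp _ (contMDiffAt_extChartAt_symm (mem_extChartAt_target p))
  have hgs : ContDiffAt ℝ ∞ g (extChartAt I p p) := by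
    have := contDiffAt_extChartAt_comp hsm
    rwa [extChartAt_symm_self] at this
  have hsrc : ∀ᶠ y in 𝓝 (extChartAt I p p),
      f ((extChartAt I p).symm y) ∈ (extChartAt I' (f p)).source := by
    refine hsm.continuousAt ?_
    rw [extChartAt_symm_self]
    exact extChartAt_source_mem_nhds _
  have hdf : ∀ v : E, (mfderiv I I' f p v : E') = fderiv ℝ g (extChartAt I p p) v := by
    intro v
    have hc : MDifferentiableAt I' 𝓘(ℝ, E') (extChartAt I' (f p)) (f p) :=
      (contMDiffAt_extChartAt (I := I') (n := ∞)).mdifferentiableAt (by simp)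
    rw [hg, ← dirDeriv_eq_fderiv (f := fun q => extChartAt I' (f p) (f q)) (hc.comp p (hd p))]
    exact ((DFunLike.congr_fun (mfderiv_comp p hc (hd p)) v).trans
      (mfderiv_extChartAt_self_apply _ _)).symm
  have rel : ∀ (V : ∀ x : N, TangentSpace I x) (V' : ∀ x : N', TangentSpace I' x),
      (∀ q, mfderiv I I' f q (V q) = V' (f q)) →
      (fun y => fderiv ℝ g y (vfChart I V p y)) =ᶠ[𝓝 (extChartAt I p p)]
        fun y => vfChart I' V' (f p) (g y) := by
    intro V V' h
    filter_upwards [hsrc, eventually_mem_extChartAt_target (I := I) p] with y hy hyt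
    have e1 : ∀ q, q = f ((extChartAt I p).symm y) →
        (mfderiv I' 𝓘(ℝ, E') (extChartAt I' (f p)) q (V' q) : E') =
        mfderiv I' 𝓘(ℝ, E') (extChartAt I' (f p)) (f ((extChartAt I p).symm y))
          (V' (f ((extChartAt I p).symm y))) := by
      rintro q rfl; rfl
    refine Eq.symm ((e1 _ ((extChartAt I' (f p)).left_inv hy)).trans ?_)
    rw [← h, ← mfderiv_symm_mfderiv_extChartAt hyt (V ((extChartAt I p).symm y))]
    have hc : MDifferentiableAt I' 𝓘(ℝ, E') (extChartAt I' (f p)) (f ((extChartAt I p).symm y)) :=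
      (contMDiffAt_extChartAt_of_mem hy).mdifferentiableAt (by simp)
    have hs := mdifferentiableAt_extChartAt_symm hyt
    have h2 := mfderiv_comp y (hc.comp _ (hd _)) hs
    rw [mfderiv_eq_fderiv, mfderiv_comp _ hc (hd _)] at h2
    exact (DFunLike.congr_fun h2 _).symm
  have hsymm := hgs.fderiv_fderiv_symm
  have hdg : DifferentiableAt ℝ g (extChartAt I p p) := hgs.differentiableAt (by simp)
  have hd2g : DifferentiableAt ℝ (fderiv ℝ g) (extChartAt I p p) := hgs.differentiableAt_fderiv
  -- The relation `Dg · V = V' ∘ g`, differentiated at the centre of the chart in the direction `w`.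
  have der : ∀ (V : ∀ x : N, TangentSpace I x) (V' : ∀ x : N', TangentSpace I' x),
      (∀ q, mfderiv I I' f q (V q) = V' (f q)) →
      DifferentiableAt ℝ (vfChart I V p) (extChartAt I p p) →
      DifferentiableAt ℝ (vfChart I' V' (f p)) (extChartAt I' (f p) (f p)) → ∀ w : E,
      fderiv ℝ (fderiv ℝ g) (extChartAt I p p) w (V p) +
        fderiv ℝ g (extChartAt I p p) (fderiv ℝ (vfChart I V p) (extChartAt I p p) w) =
      fderiv ℝ (vfChart I' V' (f p)) (extChartAt I' (f p) (f p))
        (fderiv ℝ g (extChartAt I p p) w) := by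
    intro V V' h hV hV' w
    have h1 := (hd2g.hasFDerivAt.clm_apply hV.hasFDerivAt).fderiv
    have h2 : HasFDerivAt (vfChart I' V' (f p))
        (fderiv ℝ (vfChart I' V' (f p)) (extChartAt I' (f p) (f p))) (g (extChartAt I p p)) := by
      rw [show g (extChartAt I p p) = _ from hfp]; exact hV'.hasFDerivAt
    have h3 : fderiv ℝ (fun y => vfChart I' V' (f p) (g y)) (extChartAt I p p) =
        (fderiv ℝ (vfChart I' V' (f p)) (extChartAt I' (f p) (f p))).comp
          (fderiv ℝ g (extChartAt I p p)) :=
      (HasFDerivAt.comp (extChartAt I p p) h2 hdg.hasFDerivAt).fderiv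
    have h4 := (rel V V' h).fderiv_eq (𝕜 := ℝ)
    rw [h1] at h4
    have h5 := DFunLike.congr_fun (h4.trans h3) w
    rw [add_apply, ContinuousLinearMap.flip_apply, vfChart_self] at h5
    rw [add_comm]
    exact h5
  have e1 := der W W' relW hW hW' (V p)
  have e2 := der V V' relV hV hV' (W p)
  rw [show fderiv ℝ g (extChartAt I p p) (V p) = (V' (f p) : E') from
    (hdf _).symm.trans (relV p)] at e1
  rw [show fderiv ℝ g (extChartAt I p p) (W p) = (W' (f p) : E') from
    (hdf _).symm.trans (relW p)] at e2
  -- The two terms with `D²g` agree by symmetry, so they cancel in the difference of `e1` and `e2`.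
  have e3 := hsymm (V p) (W p)
  rw [e3] at e1
  refine Eq.trans ?_ (mlieBracket_eq_chart V' W' (f p)).symm
  rw [← e1, ← e2]
  refine (congrArg (mfderiv I I' f p) (mlieBracket_eq_chart V W p)).trans ((hdf _).trans ?_)
  rw [(fderiv ℝ g (extChartAt I p p)).map_sub]
  abel

end Fields

/-! ### Commutators of local flows in a normed space -/

section Commutator

variable {E F : Type*} [NormedAddCommGroup E] [NormedSpace ℝ E] [NormedAddCommGroup F]
  [NormedSpace ℝ F]

theorem fderiv_inr_of_eventuallyEq {S : E × F → F} {h₀ : E} {y : F}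
    (hS : DifferentiableAt ℝ S (h₀, y)) (hid : ∀ᶠ z in 𝓝 y, S (h₀, z) = z) (v : F) :
    fderiv ℝ S (h₀, y) (0, v) = v := by
  have h1 : HasFDerivAt (fun z => S (h₀, z)) _ y :=
    HasFDerivAt.comp y hS.hasFDerivAt (hasFDerivAt_prodMk_right h₀ y)
  have h2 : HasFDerivAt (fun z => S (h₀, z)) (.id ℝ F) y :=
    (hasFDerivAt_id y).congr_of_eventuallyEq hid
  simpa using DFunLike.congr_fun (h1.unique h2) v

/-- The mixed second derivative of the commutator of two local flows in a normed space. -/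
theorem hasDerivAt_commutator {S : E × F → F} {h₀ : E} {y₀ : F} (hS : ContDiffAt ℝ ∞ S (h₀, y₀))
    (hid : ∀ᶠ y in 𝓝 y₀, S (h₀, y) = y) {α β : ℝ → E} {ξ η : E} (hα : HasDerivAt α ξ 0)
    (hβ : HasDerivAt β η 0) (hα0 : α 0 = h₀) (hβ0 : β 0 = h₀) :
    ∃ w : ℝ → F, (∀ᶠ s in 𝓝 (0 : ℝ),
      HasDerivAt (fun t => S (β (-s), S (α (-t), S (β s, S (α t, y₀))))) (w s) 0) ∧
      HasDerivAt w (fderiv ℝ (fun y => fderiv ℝ S (h₀, y) (η, 0)) y₀ (fderiv ℝ S (h₀, y₀) (ξ, 0)) -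
        fderiv ℝ (fun y => fderiv ℝ S (h₀, y) (ξ, 0)) y₀ (fderiv ℝ S (h₀, y₀) (η, 0))) 0 := by
  have hdiff : ∀ᶠ q in 𝓝 (h₀, y₀), DifferentiableAt ℝ S q := by
    have : ContDiffAt ℝ 1 S (h₀, y₀) := hS.of_le (by simp)
    filter_upwards [this.eventually (by simp)] with q hq
    exact hq.differentiableAt (by simp)
  have hS0 : DifferentiableAt ℝ S (h₀, y₀) := hdiff.self_of_nhds
  have hy0 : S (h₀, y₀) = y₀ := hid.self_of_nhds
  have hneg : HasDerivAt (fun t : ℝ => -t) (-1) 0 := hasDerivAt_neg 0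
  have hα' : HasDerivAt (fun t => α (-t)) (-ξ) 0 := by
    have := HasDerivAt.scomp (0 : ℝ) (h := fun t : ℝ => -t) (g₁ := α) (g₁' := ξ)
      (by simpa using hα) hneg
    simpa [Function.comp_def] using this
  have hβ' : HasDerivAt (fun t => β (-t)) (-η) 0 := by
    have := HasDerivAt.scomp (0 : ℝ) (h := fun t : ℝ => -t) (g₁ := β) (g₁' := η)
      (by simpa using hβ) hneg
    simpa [Function.comp_def] using this
  set X : F → F := fun y => fderiv ℝ S (h₀, y) (ξ, 0) with hX
  set c : ℝ → F := fun s => S (β s, y₀) with hc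
  have hc' : HasDerivAt c (fderiv ℝ S (h₀, y₀) (η, 0)) 0 :=
    HasFDerivAt.comp_hasDerivAt_of_eq 0 hS0.hasFDerivAt (hβ.prodMk (hasDerivAt_const 0 y₀))
      (by simp [hβ0])
  have hc0 : c 0 = y₀ := by simp [hc, hβ0, hy0]
  have t1 : Filter.Tendsto (fun s => (β s, y₀)) (𝓝 (0 : ℝ)) (𝓝 (h₀, y₀)) := by
    have := (hβ.continuousAt.prodMk continuousAt_const : ContinuousAt (fun s => (β s, y₀)) 0)
    simpa [ContinuousAt, hβ0] using this
  have t2 : Filter.Tendsto (fun s => (h₀, c s)) (𝓝 (0 : ℝ)) (𝓝 (h₀, y₀)) := by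
    have := (continuousAt_const.prodMk hc'.continuousAt : ContinuousAt (fun s => (h₀, c s)) 0)
    simpa [ContinuousAt, hc0] using this
  have t3 : Filter.Tendsto (fun s => (β (-s), c s)) (𝓝 (0 : ℝ)) (𝓝 (h₀, y₀)) := by
    have := (hβ'.continuousAt.prodMk hc'.continuousAt : ContinuousAt (fun s => (β (-s), c s)) 0)
    simpa [ContinuousAt, hc0, hβ0] using this
  have t4 : Filter.Tendsto c (𝓝 (0 : ℝ)) (𝓝 y₀) := by
    simpa [ContinuousAt, hc0] using hc'.continuousAt
  -- The `t`-derivative at `t = 0` for fixed `s`. The first factor moves `y₀` with velocity `X y₀`,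
  -- which is transported by `S (β s, ·)`. The third subtracts `X (c s)`, and being the identity at
  -- `t = 0` it does not alter the transported vector. The last factor transports the result.
  refine ⟨fun s => fderiv ℝ S (β (-s), c s) (0, fderiv ℝ S (β s, y₀) (0, X y₀) - X (c s)), ?_, ?_⟩
  · filter_upwards [t1 hdiff, t2 hdiff, t3 hdiff, t4 hid.eventually_nhds] with s d1 d2 d3 h4
    have e4 : S (h₀, c s) = c s := h4.self_of_nhds
    have f1 : HasDerivAt (fun t => S (α t, y₀)) (X y₀) 0 :=
      HasFDerivAt.comp_hasDerivAt_of_eq 0 hS0.hasFDerivAt (hα.prodMk (hasDerivAt_const 0 y₀))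
        (by simp [hα0])
    have f2 : HasDerivAt (fun t => S (β s, S (α t, y₀))) (fderiv ℝ S (β s, y₀) (0, X y₀)) 0 :=
      HasFDerivAt.comp_hasDerivAt_of_eq 0 (DifferentiableAt.hasFDerivAt d1)
        ((hasDerivAt_const 0 (β s)).prodMk f1) (by simp [hα0, hy0])
    have f3 : HasDerivAt (fun t => S (α (-t), S (β s, S (α t, y₀))))
        (fderiv ℝ S (h₀, c s) (-ξ, fderiv ℝ S (β s, y₀) (0, X y₀))) 0 :=
      HasFDerivAt.comp_hasDerivAt_of_eq 0 (DifferentiableAt.hasFDerivAt d2)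
        (hα'.prodMk f2) (by simp [hα0, hy0, hc])
    have e5 : fderiv ℝ S (h₀, c s) (-ξ, fderiv ℝ S (β s, y₀) (0, X y₀)) =
        fderiv ℝ S (β s, y₀) (0, X y₀) - X (c s) := by
      have : ((-ξ, fderiv ℝ S (β s, y₀) (0, X y₀)) : E × F) =
        (0, fderiv ℝ S (β s, y₀) (0, X y₀)) - (ξ, 0) := by simp
      rw [this, map_sub, fderiv_inr_of_eventuallyEq d2 h4]
    rw [e5] at f3
    exact HasFDerivAt.comp_hasDerivAt_of_eq 0 (DifferentiableAt.hasFDerivAt d3)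
        ((hasDerivAt_const 0 (β (-s))).prodMk f3) (by simp only [neg_zero, hα0, hy0]; rw [show S (β s, y₀) = c s from rfl, e4])
  · have hD2 := hS.differentiableAt_fderiv
    have hin : ∀ k : E, HasFDerivAt (fun y => fderiv ℝ S (h₀, y) (k, 0))
        ((ContinuousLinearMap.apply ℝ F ((k, 0) : E × F)).comp
          ((fderiv ℝ (fderiv ℝ S) (h₀, y₀)).comp (.inr ℝ E F))) y₀ := fun k =>
      (ContinuousLinearMap.apply ℝ F ((k, 0) : E × F)).hasFDerivAt.comp y₀
        (HasFDerivAt.comp y₀ hD2.hasFDerivAt (hasFDerivAt_prodMk_right h₀ y₀))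
    have hL : HasDerivAt (fun s => fderiv ℝ S (β (-s), c s))
        (fderiv ℝ (fderiv ℝ S) (h₀, y₀) (-η, fderiv ℝ S (h₀, y₀) (η, 0))) 0 :=
      HasFDerivAt.comp_hasDerivAt_of_eq 0 hD2.hasFDerivAt (hβ'.prodMk hc')
        (by simp [hβ0, hc0])
    have hm1 : HasDerivAt (fun s => fderiv ℝ S (β s, y₀))
        (fderiv ℝ (fderiv ℝ S) (h₀, y₀) (η, 0)) 0 :=
      HasFDerivAt.comp_hasDerivAt_of_eq 0 hD2.hasFDerivAt (hβ.prodMk (hasDerivAt_const 0 y₀))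
        (by simp [hβ0])
    have hm1' := hm1.clm_apply (hasDerivAt_const (0 : ℝ) ((0, X y₀) : E × F))
    have hm2 : HasDerivAt (fun s => X (c s)) (fderiv ℝ X y₀ (fderiv ℝ S (h₀, y₀) (η, 0))) 0 :=
      HasFDerivAt.comp_hasDerivAt_of_eq 0 (hin ξ).differentiableAt.hasFDerivAt hc' hc0.symm
    have hm := (hasDerivAt_const (0 : ℝ) (0 : E)).prodMk (hm1'.sub hm2)
    -- At `s = 0` the vector in the second slot vanishes, so the derivative of the operator drops
    -- out, and the operator itself acts as the identity on `(0, v)`. Only the derivative of the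
    -- vector remains.
    have := hL.clm_apply hm
    refine this.congr_deriv ?_
    -- Exchanging the group and space derivatives turns the remaining mixed term into the derivative
    -- along `X y₀` of the field generated by `η`.
    have hs := hS.fderiv_fderiv_symm (0, X y₀) (η, 0)
    have e1 : fderiv ℝ S (h₀, y₀) (0, X y₀) = X y₀ := fderiv_inr_of_eventuallyEq hS0 hid _
    rw [(hin η).fderiv]
    simp only [Pi.sub_apply, hβ0, neg_zero, hc0, e1, sub_self, map_zero, add_zero, zero_add,
      Prod.mk_zero_zero, fderiv_inr_of_eventuallyEq hS0 hid, ContinuousLinearMap.comp_apply,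
      ContinuousLinearMap.apply_apply, ContinuousLinearMap.inr_apply]
    rw [← hs]

end Commutator

/-! ### Vector fields generated by a local action -/

section OrbitField

open VectorField

variable {EG : Type*} [NormedAddCommGroup EG] [NormedSpace ℝ EG]
  {HG : Type*} [TopologicalSpace HG] {IG : ModelWithCorners ℝ EG HG} [IG.Boundaryless]
  {G : Type*} [TopologicalSpace G] [ChartedSpace HG G] [Group G] [IsManifold IG ∞ G]
  {E : Type*} [NormedAddCommGroup E] [NormedSpace ℝ E]
  {H : Type*} [TopologicalSpace H] (I : ModelWithCorners ℝ E H) [I.Boundaryless]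
  {N : Type*} [TopologicalSpace N] [ChartedSpace H N] [IsManifold I ∞ N]

/-- The vector field on `N` generated by `ξ ∈ Lie(G)` and a map `a : N → G → N`, thought of as a
local right action of `G`. -/
noncomputable def orbitField (a : N → G → N) (ξ : GroupLieAlgebra IG G) (x : N) :
    TangentSpace I x :=
  (mfderiv IG I (a x) 1 ξ : E)

variable (IG) in
/-- A map `a : N → G → N`, thought of as a local right action, read in the preferred chart at `p`. -/
noncomputable def actionChart (a : N → G → N) (p : N) (q : EG × E) : E :=
  extChartAt I p (a ((extChartAt I p).symm q.2) ((extChartAt IG (1 : G)).symm q.1))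

variable {I} {a : N → G → N} (ha1 : ∀ x, a x 1 = x)
  (ha : ∀ x, ContMDiffAt (I.prod IG) I ∞ (fun q : N × G => a q.1 q.2) (x, 1))
include ha1 ha

theorem contDiffAt_actionChart (p : N) :
    ContDiffAt ℝ ∞ (actionChart IG I a p) (extChartAt IG (1 : G) 1, extChartAt I p p) := by
  have h1 : ContMDiffAt 𝓘(ℝ, EG × E) I ∞ (fun q : EG × E => (extChartAt I p).symm q.2)
      (extChartAt IG (1 : G) 1, extChartAt I p p) :=
    ContMDiffAt.comp _ (contMDiffAt_extChartAt_symm (I := I) (mem_extChartAt_target p))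
      contDiff_snd.contMDiff.contMDiffAt
  have h2 : ContMDiffAt 𝓘(ℝ, EG × E) IG ∞ (fun q : EG × E => (extChartAt IG (1 : G)).symm q.1)
      (extChartAt IG (1 : G) 1, extChartAt I p p) :=
    ContMDiffAt.comp _ (contMDiffAt_extChartAt_symm (I := IG) (mem_extChartAt_target (1 : G)))
      contDiff_fst.contMDiff.contMDiffAt
  have h3 : ContMDiffAt 𝓘(ℝ, EG × E) I ∞ (fun q : EG × E =>
      a ((extChartAt I p).symm q.2) ((extChartAt IG (1 : G)).symm q.1))
      (extChartAt IG (1 : G) 1, extChartAt I p p) :=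
    (ha p).comp_of_eq (h1.prodMk h2) (by simp)
  have h4 := contDiffAt_extChartAt_comp h3
  simpa [ha1] using! h4

theorem mdifferentiableAt_orbitMap (x : N) : MDifferentiableAt IG I (a x) 1 :=
  MDifferentiableAt.comp (1 : G) (f := fun g : G => (x, g)) ((ha x).mdifferentiableAt (by simp))
    (mdifferentiableAt_const.prodMk mdifferentiableAt_id)

/-- By the chain rule, and since `a q 1 = q`, the orbit velocity in the chart at `p` is the partial
derivative of `actionChart` in the group variable. Smoothness of the field and the commutator
formula thus become statements about one smooth map of normed spaces. -/
theorem vfChart_orbitField (p : N) (ξ : GroupLieAlgebra IG G) :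
    vfChart I (orbitField I a ξ) p =ᶠ[𝓝 (extChartAt I p p)] fun y =>
      fderiv ℝ (actionChart IG I a p) (extChartAt IG (1 : G) 1, y) ((ξ : EG), (0 : E)) := by
  have hS := contDiffAt_actionChart ha1 ha p
  have hdiff : ∀ᶠ y in 𝓝 (extChartAt I p p),
      DifferentiableAt ℝ (actionChart IG I a p) (extChartAt IG (1 : G) 1, y) := by
    have h1 : ContDiffAt ℝ 1 (actionChart IG I a p) (extChartAt IG (1 : G) 1, extChartAt I p p) :=
      hS.of_le (by simp)
    have h2 : ContinuousAt (fun y : E => (extChartAt IG (1 : G) 1, y)) (extChartAt I p p) := by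
      fun_prop
    filter_upwards [h2 (h1.eventually (by simp))] with y hy
    exact ContDiffAt.differentiableAt (n := 1) hy (by simp)
  filter_upwards [hdiff, eventually_mem_extChartAt_target (I := I) p] with y hy hyt
  set q := (extChartAt I p).symm y with hq
  have hqs : q ∈ (extChartAt I p).source := (extChartAt I p).map_target hyt
  have hc : MDifferentiableAt I 𝓘(ℝ, E) (extChartAt I p) (a q 1) := by
    rw [ha1]; exact (contMDiffAt_extChartAt_of_mem hqs).mdifferentiableAt (by simp)
  have ho := mdifferentiableAt_orbitMap ha1 ha q
  have e1 : ∀ q', q' = q → ∀ v : E, (mfderiv I 𝓘(ℝ, E) (extChartAt I p) q v : E) =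
      (mfderiv I 𝓘(ℝ, E) (extChartAt I p) q' v : E) := by rintro q' rfl v; rfl
  have e2 : vfChart I (orbitField I a ξ) p y =
      dirDeriv IG (fun g => extChartAt I p (a q g)) 1 ξ :=
    (e1 _ (ha1 q) _).trans (DFunLike.congr_fun (mfderiv_comp (1 : G) hc ho) ξ).symm
  have h5 : HasFDerivAt (fun h => actionChart IG I a p (h, y)) _ (extChartAt IG (1 : G) 1) :=
    HasFDerivAt.comp (g := actionChart IG I a p) (extChartAt IG (1 : G) 1) hy.hasFDerivAt (hasFDerivAt_prodMk_left _ y)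
  exact e2.trans ((dirDeriv_eq_fderiv (hc.comp _ ho) ξ).trans (DFunLike.congr_fun h5.fderiv ξ))

theorem contDiffAt_vfChart_orbitField (p : N) (ξ : GroupLieAlgebra IG G) :
    ContDiffAt ℝ ∞ (vfChart I (orbitField I a ξ) p) (extChartAt I p p) := by
  refine ContDiffAt.congr_of_eventuallyEq ?_ (vfChart_orbitField ha1 ha p ξ)
  have h1 := (contDiffAt_actionChart ha1 ha p).contDiffAt_fderiv_infty
  have h2 : ContDiffAt ℝ ∞ (fun y : E => (extChartAt IG (1 : G) 1, y)) (extChartAt I p p) :=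
    contDiffAt_const.prodMk contDiffAt_id
  exact (ContDiffAt.comp (extChartAt I p p) h1 h2).clm_apply contDiffAt_const

theorem differentiableAt_vfChart_orbitField (p : N) (ξ : GroupLieAlgebra IG G) :
    DifferentiableAt ℝ (vfChart I (orbitField I a ξ) p) (extChartAt I p p) :=
  (contDiffAt_vfChart_orbitField ha1 ha p ξ).differentiableAt (by simp)

/-- The mixed second derivative of the commutator of two local flows is the Lie bracket of
the vector fields which generate them. -/
theorem hasMixedDeriv_commutator (p : N) {α β : ℝ → G} {ξ η : GroupLieAlgebra IG G}
    (hα0 : α 0 = 1) (hβ0 : β 0 = 1) (hαc : ContinuousAt α 0) (hβc : ContinuousAt β 0)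
    (hα : HasDerivAt (fun t => extChartAt IG (1 : G) (α t)) (ξ : EG) 0)
    (hβ : HasDerivAt (fun t => extChartAt IG (1 : G) (β t)) (η : EG) 0) :
    HasMixedDeriv I (fun t s => a (a (a (a p (α t)) (β s)) (α (-t))) (β (-s))) p
      (mlieBracket I (orbitField I a ξ) (orbitField I a η) p) := by
  have hid : ∀ᶠ y in 𝓝 (extChartAt I p p),
      actionChart IG I a p (extChartAt IG (1 : G) 1, y) = y := by
    filter_upwards [eventually_mem_extChartAt_target (I := I) p] with y hy
    simp only [actionChart, extChartAt_symm_self, ha1, (extChartAt I p).right_inv hy]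
  obtain ⟨w, hw1, hw2⟩ := hasDerivAt_commutator (contDiffAt_actionChart ha1 ha p) hid hα hβ
    (by rw [hα0]) (by rw [hβ0])
  have cα : ContinuousAt (fun q : ℝ × ℝ => α q.2) (0, 0) :=
    ContinuousAt.comp (g := α) hαc continuousAt_snd
  have cα' : ContinuousAt (fun q : ℝ × ℝ => α (-q.2)) (0, 0) :=
    ContinuousAt.comp (g := α) (by simpa using hαc) (continuous_snd.neg.continuousAt)
  have cβ : ContinuousAt (fun q : ℝ × ℝ => β q.1) (0, 0) :=
    ContinuousAt.comp (g := β) hβc continuousAt_fst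
  have cβ' : ContinuousAt (fun q : ℝ × ℝ => β (-q.1)) (0, 0) :=
    ContinuousAt.comp (g := β) (by simpa using hβc) (continuous_fst.neg.continuousAt)
  have step : ∀ (f : ℝ × ℝ → N) (γ : ℝ × ℝ → G), ContinuousAt f (0, 0) → ContinuousAt γ (0, 0) →
      f (0, 0) = p → γ (0, 0) = 1 → ContinuousAt (fun q => a (f q) (γ q)) (0, 0) :=
    fun f γ hf hγ h1 h2 => ContinuousAt.comp_of_eq (ha p).continuousAt (hf.prodMk hγ)
      (by rw [h1, h2])
  have c1 := step (fun _ => p) _ continuousAt_const cα rfl hα0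
  have c2 := step _ _ c1 cβ (by simp [hα0, ha1]) hβ0
  have c3 := step _ _ c2 cα' (by simp [hα0, hβ0, ha1]) (by simp [hα0])
  have src : ∀ f : ℝ × ℝ → N, ContinuousAt f (0, 0) → f (0, 0) = p →
      ∀ᶠ q in 𝓝 (0, 0), f q ∈ (extChartAt I p).source := fun f hf h0 =>
    hf (by rw [h0]; exact extChartAt_source_mem_nhds p)
  have srcG : ∀ f : ℝ × ℝ → G, ContinuousAt f (0, 0) → f (0, 0) = 1 →
      ∀ᶠ q in 𝓝 (0, 0), f q ∈ (extChartAt IG (1 : G)).source := fun f hf h0 =>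
    hf (by rw [h0]; exact extChartAt_source_mem_nhds 1)
  have act : ∀ (x : N) (g : G), x ∈ (extChartAt I p).source →
      g ∈ (extChartAt IG (1 : G)).source →
      actionChart IG I a p (extChartAt IG (1 : G) g, extChartAt I p x) = extChartAt I p (a x g) := by
    intro x g hx hg
    simp only [actionChart, (extChartAt I p).left_inv hx, (extChartAt IG (1 : G)).left_inv hg]
  -- Joint continuity keeps all intermediate points and group elements in the chart domains for
  -- small parameters. Here `q = (s, t)`, so that currying gives "for `s` near `0`, for `t` near
  -- `0`", the order required by `HasMixedDeriv`.
  have ev : ∀ᶠ q : ℝ × ℝ in 𝓝 (0, 0),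
      extChartAt I p (a (a (a (a p (α q.2)) (β q.1)) (α (-q.2))) (β (-q.1))) =
      actionChart IG I a p (extChartAt IG (1 : G) (β (-q.1)), actionChart IG I a p
        (extChartAt IG (1 : G) (α (-q.2)), actionChart IG I a p (extChartAt IG (1 : G) (β q.1),
          actionChart IG I a p (extChartAt IG (1 : G) (α q.2), extChartAt I p p)))) := by
    filter_upwards [src _ c1 (by simp [hα0, ha1]), src _ c2 (by simp [hα0, hβ0, ha1]),
      src _ c3 (by simp [hα0, hβ0, ha1]), srcG _ cα (by simp [hα0]), srcG _ cα' (by simp [hα0]),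
      srcG _ cβ (by simp [hβ0]), srcG _ cβ' (by simp [hβ0])] with q h1 h2 h3 g1 g2 g3 g4
    rw [act _ _ (mem_extChartAt_source p) g1, act _ _ h1 g3, act _ _ h2 g2, act _ _ h3 g4]
  refine ⟨w, ?_, ?_⟩
  · filter_upwards [hw1, ev.curry_nhds] with s hs1 hs2
    exact hs1.congr_of_eventuallyEq hs2
  · refine hw2.congr_deriv (Eq.trans ?_ (mlieBracket_eq_chart _ _ p).symm)
    have hX := vfChart_orbitField ha1 ha p ξ
    have hY := vfChart_orbitField ha1 ha p η
    have e1 := hX.self_of_nhds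
    have e2 := hY.self_of_nhds
    rw [vfChart_self] at e1 e2
    rw [hX.fderiv_eq, hY.fderiv_eq]
    erw [e1, e2]

end OrbitField

/-! ### Initial velocity of one-parameter subgroups -/

section ExpCurve

variable {EG : Type*} [NormedAddCommGroup EG] [NormedSpace ℝ EG] [CompleteSpace EG]
  {HG : Type*} [TopologicalSpace HG] {IG : ModelWithCorners ℝ EG HG} [IG.Boundaryless]
  {G : Type*} [TopologicalSpace G] [ChartedSpace HG G] [Group G] [LieGroup IG ∞ G] [T2Space G]

theorem expCurve_zero (ξ : GroupLieAlgebra IG G) : expCurve ξ 0 = 1 :=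
  (Classical.choose_spec (exists_oneParameterSubgroup ξ)).1

theorem hasMFDerivAt_expCurve (ξ : GroupLieAlgebra IG G) (t : ℝ) :
    HasMFDerivAt 𝓘(ℝ, ℝ) IG (expCurve ξ) t
      ((1 : ℝ →L[ℝ] ℝ).smulRight (mulInvariantVectorField ξ (expCurve ξ t))) :=
  (Classical.choose_spec (exists_oneParameterSubgroup ξ)).2 t

theorem continuousAt_expCurve (ξ : GroupLieAlgebra IG G) (t : ℝ) : ContinuousAt (expCurve ξ) t :=
  (hasMFDerivAt_expCurve ξ t).continuousAt

theorem mulInvariantVectorField_one (ξ : GroupLieAlgebra IG G) :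
    mulInvariantVectorField ξ (1 : G) = ξ := by
  have : (fun x : G => 1 * x) = id := by ext; simp
  unfold mulInvariantVectorField
  rw [this, mfderiv_id]
  rfl

theorem hasDerivAt_extChartAt_expCurve (ξ : GroupLieAlgebra IG G) :
    HasDerivAt (fun t => extChartAt IG (1 : G) (expCurve ξ t)) (ξ : EG) 0 := by
  have : IsManifold IG ∞ G := inferInstance
  have h := hasMFDerivAt_expCurve ξ 0
  have hd := h.mdifferentiableAt
  have e1 : ∀ g : G, g = 1 → ((mfderiv IG 𝓘(ℝ, EG) (extChartAt IG (1 : G)) g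
      (mulInvariantVectorField ξ g) : EG) = ξ) := by
    rintro g rfl
    rw [mulInvariantVectorField_one]
    exact mfderiv_extChartAt_self_apply _ _
  have hc : MDifferentiableAt IG 𝓘(ℝ, EG) (extChartAt IG (1 : G)) (expCurve ξ 0) := by
    rw [expCurve_zero]
    exact (contMDiffAt_extChartAt (I := IG) (n := ∞)).mdifferentiableAt (by simp)
  have h2 : ∃ L : ℝ →L[ℝ] EG,
      HasFDerivAt (fun t => extChartAt IG (1 : G) (expCurve ξ t)) L 0 ∧ L 1 = ξ := by
    refine ⟨_, (hc.hasMFDerivAt.comp 0 h).hasFDerivAt, Eq.trans ?_ (e1 _ (expCurve_zero ξ))⟩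
    exact congrArg (mfderiv IG 𝓘(ℝ, EG) (extChartAt IG (1 : G)) (expCurve ξ 0)) (one_smul ℝ _)
  obtain ⟨L, hL, hL1⟩ := h2
  exact hL1 ▸ hL.hasDerivAt

end ExpCurve

/-! ### Fundamental fields of a smooth right action -/

section GroupAction

open VectorField

variable {EG : Type*} [NormedAddCommGroup EG] [NormedSpace ℝ EG]
  {HG : Type*} [TopologicalSpace HG] {IG : ModelWithCorners ℝ EG HG} [IG.Boundaryless]
  {G : Type*} [TopologicalSpace G] [ChartedSpace HG G] [Group G] [LieGroup IG ∞ G]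
  {E : Type*} [NormedAddCommGroup E] [NormedSpace ℝ E]
  {H : Type*} [TopologicalSpace H] {I : ModelWithCorners ℝ E H} [I.Boundaryless]
  {N : Type*} [TopologicalSpace N] [ChartedSpace H N] [IsManifold I ∞ N]

/-- For a right action, the bracket of fundamental vector fields is the fundamental vector field
of the bracket. -/
theorem mlieBracket_orbitField {a : N → G → N} (ha1 : ∀ x, a x 1 = x)
    (hmul : ∀ x g h, a (a x g) h = a x (g * h))
    (ha : ContMDiff (I.prod IG) I ∞ (fun q : N × G => a q.1 q.2)) (ξ η : GroupLieAlgebra IG G)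
    (x : N) :
    mlieBracket I (orbitField I a ξ) (orbitField I a η) x = orbitField I a ⁅ξ, η⁆ x := by
  have : IsManifold IG ∞ G := inferInstance
  have hax : ContMDiff IG I ∞ (a x) := ha.comp (contMDiff_const.prodMk contMDiff_id)
  have hd : ∀ g, MDifferentiableAt IG I (a x) g := fun g => (hax g).mdifferentiableAt (by simp)
  -- Left-invariant fields are the orbit fields of right multiplication of `G` on itself. By `hmul`
  -- the orbit map `a x` carries them to the orbit fields on `N`.
  have rel : ∀ (ξ : GroupLieAlgebra IG G) (g : G),
      mfderiv IG I (a x) g (orbitField IG (fun g h : G => g * h) ξ g) =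
        orbitField I a ξ (a x g) := by
    intro ξ g
    have h1 : a (a x g) = a x ∘ fun h => g * h := by ext h; exact hmul x g h
    have hg : MDifferentiableAt IG IG (fun h : G => g * h) 1 :=
      (contMDiff_mul_left (I := IG) (n := ∞) (a := g)).contMDiffAt.mdifferentiableAt (by simp)
    have h2 := mfderiv_comp (1 : G) (hd _) hg
    rw [← h1] at h2
    have h3 : ∀ g', g' = g → ∀ v : EG, (mfderiv IG I (a x) g v : E) = mfderiv IG I (a x) g' v := by
      rintro g' rfl v; rfl
    exact (h3 _ (mul_one g) _).trans (DFunLike.congr_fun h2 ξ).symm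
  have haG : ContMDiff (IG.prod IG) IG ∞ (fun q : G × G => q.1 * q.2) := contMDiff_mul IG ∞
  have key := mfderiv_mlieBracket_of_related hax (1 : G)
    (differentiableAt_vfChart_orbitField (I := IG) mul_one (fun g => haG (g, 1)) 1 ξ)
    (differentiableAt_vfChart_orbitField (I := IG) mul_one (fun g => haG (g, 1)) 1 η)
    (differentiableAt_vfChart_orbitField ha1 (fun y => ha (y, 1)) (a x 1) ξ)
    (differentiableAt_vfChart_orbitField ha1 (fun y => ha (y, 1)) (a x 1) η)
    (rel ξ) (rel η)
  have h4 : ∀ x', x' = x → (mlieBracket I (orbitField I a ξ) (orbitField I a η) x' : E) =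
    mlieBracket I (orbitField I a ξ) (orbitField I a η) x := by rintro x' rfl; rfl
  -- `⁅ξ, η⁆` is by definition the value at `1` of the bracket of the left-invariant fields, which
  -- makes the last equality definitional.
  exact ((h4 _ (ha1 x)).symm.trans key.symm).trans rfl

theorem orbitField_add {a : N → G → N} (ξ η : GroupLieAlgebra IG G) (x : N) :
    orbitField I a (ξ + η) x = orbitField I a ξ x + orbitField I a η x :=
  (mfderiv IG I (a x) 1).map_add ξ η

theorem orbitField_smul {a : N → G → N} (c : ℝ) (ξ : GroupLieAlgebra IG G) (x : N) :
    orbitField I a (c • ξ) x = c • orbitField I a ξ x :=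
  (mfderiv IG I (a x) 1).map_smul c ξ

variable [MulAction Gᵐᵒᵖ N]

/-- The derivative of a function along a one-parameter subgroup is its derivative in the direction
of the fundamental vector field. -/
theorem lieAct_eq_dirDeriv [CompleteSpace EG] [T2Space G]
    (hact : ContMDiff (I.prod IG) I ∞ (fun q : N × G => q.1 <• q.2))
    {f : N → ℂ} {x : N} (hf : MDifferentiableAt I 𝓘(ℝ, ℂ) f x) (ξ : GroupLieAlgebra IG G) :
    lieAct ξ f x = dirDeriv I f x (fundField I ξ x) := by
  have : IsManifold IG ∞ G := inferInstance
  have hx : x <• (1 : G) = x := by simp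
  have hax : ContMDiff IG I ∞ (fun g : G => x <• g) :=
    hact.comp (contMDiff_const.prodMk contMDiff_id)
  have hd : MDifferentiableAt IG I (fun g : G => x <• g) 1 := (hax 1).mdifferentiableAt (by simp)
  have hf' : MDifferentiableAt I 𝓘(ℝ, ℂ) f (x <• (1 : G)) := by rwa [hx]
  have hφ : MDifferentiableAt IG 𝓘(ℝ, ℂ) (fun g : G => f (x <• g)) 1 := hf'.comp 1 hd
  have h1 : dirDeriv IG (fun g : G => f (x <• g)) 1 ξ = dirDeriv I f x (fundField I ξ x) := by
    have e : ∀ y, y = x → ∀ v : E, (mfderiv I 𝓘(ℝ, ℂ) f y v : ℂ) = dirDeriv I f x v := by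
      rintro y rfl v; rfl
    exact (DFunLike.congr_fun (mfderiv_comp (1 : G) hf' hd) ξ).trans (e _ hx _)
  rw [← h1]
  have h2 : DifferentiableAt ℝ (fun y : EG => f (x <• (extChartAt IG (1 : G)).symm y))
      (extChartAt IG (1 : G) 1) := by
    have := MDifferentiableAt.comp_of_eq (I := 𝓘(ℝ, EG)) (x := extChartAt IG (1 : G) 1) hφ
      (mdifferentiableAt_extChartAt_symm (I := IG) (mem_extChartAt_target (1 : G)))
      (extChartAt_symm_self (1 : G))
    exact this.differentiableAt
  have h3 := HasFDerivAt.comp_hasDerivAt_of_eq (0 : ℝ) h2.hasFDerivAt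
    (hasDerivAt_extChartAt_expCurve ξ) (by rw [expCurve_zero])
  have h4 : (fun t : ℝ => f (x <• expCurve ξ t)) =ᶠ[𝓝 0]
      (fun y : EG => f (x <• (extChartAt IG (1 : G)).symm y)) ∘
        fun t => extChartAt IG (1 : G) (expCurve ξ t) := by
    have : ∀ᶠ t in 𝓝 (0 : ℝ), expCurve ξ t ∈ (extChartAt IG (1 : G)).source :=
      continuousAt_expCurve ξ 0 (by rw [expCurve_zero]; exact extChartAt_source_mem_nhds (I := IG) 1)
    filter_upwards [this] with t ht
    simp only [Function.comp_apply, (extChartAt IG (1 : G)).left_inv ht]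
  unfold lieAct
  rw [h4.deriv_eq, h3.deriv]
  exact (dirDeriv_eq_fderiv hφ ξ).symm

end GroupAction

/-! ### The exponential map of `ℂˣ` -/

section ExpUnit

/-- The exponential map of the Lie group `ℂˣ`. -/
noncomputable def expUnit (ζ : ℂ) : ℂˣ := Units.mk0 (Complex.exp ζ) (Complex.exp_ne_zero ζ)

theorem expUnit_zero : expUnit 0 = 1 := by ext; simp [expUnit]

theorem expUnit_add (ζ ζ' : ℂ) : expUnit (ζ + ζ') = expUnit ζ * expUnit ζ' := by
  ext; simp [expUnit, Complex.exp_add]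

theorem expUnit_log (z : ℂˣ) : expUnit (Complex.log z) = z := by
  ext; simp [expUnit, Complex.exp_log]

theorem contMDiff_expUnit : ContMDiff 𝓘(ℝ, ℂ) 𝓘(ℝ, ℂ) ∞ expUnit := by
  apply ContMDiff.of_comp_isOpenEmbedding Units.isOpenEmbedding_val
  exact (Complex.contDiff_exp (𝕜 := ℝ)).contMDiff

theorem mfderiv_expUnit_zero (w : ℂ) : (mfderiv 𝓘(ℝ, ℂ) 𝓘(ℝ, ℂ) expUnit 0 w : ℂ) = w := by
  have h1 : MDifferentiableAt 𝓘(ℝ, ℂ) 𝓘(ℝ, ℂ) expUnit 0 :=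
    (contMDiff_expUnit 0).mdifferentiableAt (by simp)
  have h2 := mfderiv_eq_fderiv_extChartAt h1 w
  have h3 : fderiv ℝ Complex.exp 0 w = w := by
    rw [((Complex.hasDerivAt_exp 0).hasFDerivAt.restrictScalars ℝ).fderiv]
    simp
  have h4 : (fun y => extChartAt 𝓘(ℝ, ℂ) (expUnit 0) (expUnit y)) = Complex.exp := by
    ext y; rfl
  rw [h4, h3] at h2
  exact h2

end ExpUnit

/-! ### Local coordinates `(ζ, y) ↦ e^ζ s(y)` on a principal bundle -/

section PrincipalBundle

variable {EM : Type*} [NormedAddCommGroup EM] [NormedSpace ℝ EM]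
  {HM : Type*} [TopologicalSpace HM] {I : ModelWithCorners ℝ EM HM} [I.Boundaryless]
  {M : Type*} [TopologicalSpace M] [ChartedSpace HM M] [IsManifold I ∞ M]
  {EP : Type*} [NormedAddCommGroup EP] [NormedSpace ℝ EP]
  {HP : Type*} [TopologicalSpace HP] {J : ModelWithCorners ℝ EP HP} [J.Boundaryless]
  {P : Type*} [TopologicalSpace P] [ChartedSpace HP P] [IsManifold J ∞ P] [MulAction ℂˣ P]
  {E' : Type*} [NormedAddCommGroup E'] [NormedSpace ℝ E']
  {π : P → M}

theorem mfderiv_congr_base {E₁ H₁ N₁ E₂ H₂ N₂ : Type*} [NormedAddCommGroup E₁] [NormedSpace ℝ E₁]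
    [TopologicalSpace H₁] {I₁ : ModelWithCorners ℝ E₁ H₁} [TopologicalSpace N₁] [ChartedSpace H₁ N₁]
    [NormedAddCommGroup E₂] [NormedSpace ℝ E₂]
    [TopologicalSpace H₂] {I₂ : ModelWithCorners ℝ E₂ H₂} [TopologicalSpace N₂] [ChartedSpace H₂ N₂]
    (f : N₁ → N₂) {q q' : N₁} (h : q = q') (v : E₁) :
    (mfderiv I₁ I₂ f q v : E₂) = mfderiv I₁ I₂ f q' v := by
  subst h; rfl

namespace IsPrincipalCStarBundle

variable (hπ : IsPrincipalCStarBundle I J π)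
include hπ

theorem contMDiff_const_smul (z : ℂˣ) : ContMDiff J J ∞ (fun p : P => z • p) :=
  hπ.contMDiff_smul.comp (contMDiff_const.prodMk contMDiff_id)

theorem contMDiff_smul_const (p : P) : ContMDiff 𝓘(ℝ, ℂ) J ∞ (fun z : ℂˣ => z • p) :=
  hπ.contMDiff_smul.comp (contMDiff_id.prodMk contMDiff_const)

/-- Local sections of a principal bundle, with the function comparing a point to the section. -/
theorem exists_localSection (x : M) : ∃ (U : Set M) (s : M → P) (τ : P → ℂˣ), IsOpen U ∧ x ∈ U ∧
    ContMDiffOn I J ∞ s U ∧ ContMDiffOn J 𝓘(ℝ, ℂ) ∞ τ (π ⁻¹' U) ∧ (∀ y ∈ U, π (s y) = y) ∧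
    ∀ p ∈ π ⁻¹' U, τ p • s (π p) = p := by
  obtain ⟨U, hU, hx, e, hsrc, htgt, he, he', h1, h2⟩ := hπ.locally_trivial x
  have hmem : ∀ y ∈ U, ((y, (1 : ℂˣ)) : M × ℂˣ) ∈ e.target := fun y hy => by simp [htgt, hy]
  have hs : ∀ y ∈ U, e.symm (y, 1) ∈ e.source := fun y hy => e.map_target (hmem y hy)
  have hpr : ∀ y ∈ U, π (e.symm (y, 1)) = y := fun y hy => by
    rw [← h1 _ (hs y hy), e.right_inv (hmem y hy)]
  refine ⟨U, fun y => e.symm (y, 1), fun p => (e p).2, hU, hx, ?_, ?_, hpr, fun p hp => ?_⟩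
  · exact he'.comp (contMDiffOn_id.prodMk contMDiffOn_const) fun y hy => hmem y hy
  · rw [← hsrc]
    exact contMDiff_snd.comp_contMDiffOn he
  · have hp' : p ∈ e.source := by rw [hsrc]; exact hp
    have hs' := hs _ hp
    have hz : (e p).2 • e.symm (π p, 1) ∈ e.source := by
      rw [hsrc, mem_preimage, hπ.proj_smul, hpr _ hp]; exact hp
    refine e.injOn hz hp' (Prod.ext ?_ ?_)
    · rw [h1 _ hz, h1 _ hp', hπ.proj_smul, hpr _ hp]
    · rw [h2 _ hs', e.right_inv (hmem _ hp), mul_one]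

theorem surjective_proj : Function.Surjective π := fun x => by
  obtain ⟨U, s, τ, hU, hx, -, -, h, -⟩ := hπ.exists_localSection x
  exact ⟨s x, h x hx⟩

/-- The derivative of a local section is a right inverse of the derivative of `π`. One such point in
each fibre suffices for the uniqueness of the curvature. -/
theorem exists_surjective_mfderiv (x : M) : ∃ p : P, π p = x ∧
    ∀ v : EM, ∃ u : EP, (mfderiv J I π p u : EM) = v := by
  obtain ⟨U, s, τ, hU, hx, hs, -, h, -⟩ := hπ.exists_localSection x
  refine ⟨s x, h x hx, fun v => ⟨mfderiv I J s x v, ?_⟩⟩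
  have hs' : MDifferentiableAt I J s x :=
    (hs.contMDiffAt (hU.mem_nhds hx)).mdifferentiableAt (by simp)
  have hπ' : MDifferentiableAt J I π (s x) := (hπ.contMDiff_proj _).mdifferentiableAt (by simp)
  have hev : π ∘ s =ᶠ[𝓝 x] id := by
    filter_upwards [hU.mem_nhds hx] with y hy using h y hy
  have h1 := hev.mfderiv_eq (I := I) (I' := I)
  exact (DFunLike.congr_fun (mfderiv_comp x hπ' hs') v).symm.trans
    ((DFunLike.congr_fun h1 v).trans (DFunLike.congr_fun (mfderiv_id (I := I) (x := x)) v))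

theorem contMDiffAt_expUnit_smul {S : E' → P} {ζ : ℂ} {y : E'}
    (hS : ContMDiffAt 𝓘(ℝ, E') J ∞ S y) :
    ContMDiffAt 𝓘(ℝ, ℂ × E') J ∞ (fun q : ℂ × E' => expUnit q.1 • S q.2) (ζ, y) :=
  (hπ.contMDiff_smul _).comp (ζ, y)
    (((contMDiff_expUnit _).comp (ζ, y) contDiff_fst.contMDiff.contMDiffAt).prodMk
      (ContMDiffAt.comp (ζ, y) hS contDiff_snd.contMDiff.contMDiffAt))

theorem mdifferentiableAt_expUnit_smul {S : E' → P} {ζ : ℂ} {y : E'}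
    (hS : MDifferentiableAt 𝓘(ℝ, E') J S y) :
    MDifferentiableAt 𝓘(ℝ, ℂ × E') J (fun q : ℂ × E' => expUnit q.1 • S q.2) (ζ, y) :=
  MDifferentiableAt.comp (ζ, y) ((hπ.contMDiff_smul (expUnit ζ, S y)).mdifferentiableAt (by simp))
    ((MDifferentiableAt.comp (ζ, y) ((contMDiff_expUnit ζ).mdifferentiableAt (by simp))
        (contDiff_fst.contMDiff (n := ∞).contMDiffAt.mdifferentiableAt (by simp))).prodMk
      (MDifferentiableAt.comp (ζ, y) hS
        (contDiff_snd.contMDiff (n := ∞).contMDiffAt.mdifferentiableAt (by simp))))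

/-- As `expUnit` is a homomorphism, varying `ζ` moves along the orbit of `expUnit ζ • S y`, and
`expUnit` has identity derivative at `0`. -/
theorem mfderiv_expUnit_smul_vert {S : E' → P} {ζ : ℂ} {y : E'}
    (hS : MDifferentiableAt 𝓘(ℝ, E') J S y) (w : ℂ) :
    (mfderiv 𝓘(ℝ, ℂ × E') J (fun q : ℂ × E' => expUnit q.1 • S q.2) (ζ, y) (w, (0 : E')) : EP) =
      vertField J w (expUnit ζ • S y) := by
  set Φ : ℂ × E' → P := fun q => expUnit q.1 • S q.2 with hΦ
  set p := expUnit ζ • S y with hp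
  have hd := hπ.mdifferentiableAt_expUnit_smul (ζ := ζ) hS
  have hl : MDifferentiableAt 𝓘(ℝ, ℂ) 𝓘(ℝ, ℂ × E') (fun ζ' : ℂ => (ζ' + ζ, y)) 0 := by
    rw [mdifferentiableAt_iff_differentiableAt]; fun_prop
  have e1 : Φ ∘ (fun ζ' : ℂ => (ζ' + ζ, y)) = (fun z : ℂˣ => z • p) ∘ expUnit := by
    ext ζ'; simp [hΦ, hp, expUnit_add, mul_smul]
  have h1 := mfderiv_comp_of_eq (x := (0 : ℂ)) hd hl (by simp)
  have h2 := mfderiv_comp_of_eq (x := (0 : ℂ)) (f := expUnit) (y := 1)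
    (((hπ.contMDiff_smul_const p) 1).mdifferentiableAt (by simp))
    ((contMDiff_expUnit 0).mdifferentiableAt (by simp)) expUnit_zero
  rw [← hΦ, e1] at h1
  have h3 : (mfderiv 𝓘(ℝ, ℂ) 𝓘(ℝ, ℂ × E') (fun ζ' : ℂ => (ζ' + ζ, y)) 0 w : ℂ × E') = (w, 0) := by
    rw [mfderiv_eq_fderiv]
    have : HasFDerivAt (fun ζ' : ℂ => (ζ' + ζ, y)) (.inl ℝ ℂ E') 0 :=
      ((hasFDerivAt_id (𝕜 := ℝ) (0 : ℂ)).add_const ζ).prodMk (hasFDerivAt_const y (0 : ℂ))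
    rw [this.fderiv]; rfl
  have h4 := DFunLike.congr_fun (h1.symm.trans h2) w
  have h5 : (mfderiv 𝓘(ℝ, ℂ × E') J Φ (ζ, y) (w, (0 : E')) : EP) =
      mfderiv 𝓘(ℝ, ℂ × E') J Φ (0 + ζ, y)
        (mfderiv 𝓘(ℝ, ℂ) 𝓘(ℝ, ℂ × E') (fun ζ' : ℂ => (ζ' + ζ, y)) 0 w) :=
    (congrArg (mfderiv 𝓘(ℝ, ℂ × E') J Φ (ζ, y)) h3.symm).trans
      (mfderiv_congr_base Φ (by simp) _)
  refine h5.trans (Eq.trans h4 ?_)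
  have h6 : (mfderiv 𝓘(ℝ, ℂ) J (fun z : ℂˣ => z • p) (expUnit 0)
      (mfderiv 𝓘(ℝ, ℂ) 𝓘(ℝ, ℂ) expUnit 0 w) : EP) =
      mfderiv 𝓘(ℝ, ℂ) J (fun z : ℂˣ => z • p) 1 (mfderiv 𝓘(ℝ, ℂ) 𝓘(ℝ, ℂ) expUnit 0 w) :=
    mfderiv_congr_base _ expUnit_zero _
  exact h6.trans (congrArg (mfderiv 𝓘(ℝ, ℂ) J (fun z : ℂˣ => z • p) 1) (mfderiv_expUnit_zero w))

theorem mfderiv_expUnit_smul_horiz {S : E' → P} {ζ : ℂ} {y : E'}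
    (hS : MDifferentiableAt 𝓘(ℝ, E') J S y) (k : E') :
    (mfderiv 𝓘(ℝ, ℂ × E') J (fun q : ℂ × E' => expUnit q.1 • S q.2) (ζ, y) ((0 : ℂ), k) : EP) =
      mfderiv J J (fun p : P => expUnit ζ • p) (S y) (mfderiv 𝓘(ℝ, E') J S y k) := by
  set Φ : ℂ × E' → P := fun q => expUnit q.1 • S q.2 with hΦ
  have hd := hπ.mdifferentiableAt_expUnit_smul (ζ := ζ) hS
  have hl : MDifferentiableAt 𝓘(ℝ, E') 𝓘(ℝ, ℂ × E') (fun y' : E' => (ζ, y')) y := by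
    rw [mdifferentiableAt_iff_differentiableAt]; fun_prop
  have h1 := mfderiv_comp y hd hl
  have h2 := mfderiv_comp y (((hπ.contMDiff_const_smul (expUnit ζ)) (S y)).mdifferentiableAt
    (by simp)) hS
  have h3 : (mfderiv 𝓘(ℝ, E') 𝓘(ℝ, ℂ × E') (fun y' : E' => (ζ, y')) y k : ℂ × E') = (0, k) := by
    rw [mfderiv_eq_fderiv, (hasFDerivAt_prodMk_right ζ y).fderiv]; rfl
  exact (congrArg (mfderiv 𝓘(ℝ, ℂ × E') J Φ (ζ, y)) h3.symm).trans
    ((DFunLike.congr_fun h1 k).symm.trans (DFunLike.congr_fun h2 k))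

/-- The two axioms of a connection give the two summands: reproduction of generators gives `dζ`, and
invariance under `ℂˣ` gives `S^*A`. -/
theorem pullbackForm_expUnit_smul (A : ConnectionForm J P) {S : E' → P} {ζ : ℂ} {y : E'}
    (hS : MDifferentiableAt 𝓘(ℝ, E') J S y) (w : ℂ) (k : E') :
    pullbackForm J (F := ℂ) A.form (fun q : ℂ × E' => expUnit q.1 • S q.2) (ζ, y) (w, k) =
      w + pullbackForm J (F := ℂ) A.form S y k := by
  have e : ((w, k) : ℂ × E') = (w, 0) + (0, k) := by simp
  rw [e, map_add]
  refine congrArg₂ (· + ·) ?_ ?_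
  · exact (congrArg (A.form _) (hπ.mfderiv_expUnit_smul_vert hS w)).trans (A.form_vertField _ _)
  · exact (congrArg (A.form _) (hπ.mfderiv_expUnit_smul_horiz hS k)).trans (A.form_smul _ _ _)

/-- The exterior derivative of a connection form is determined by its pullback along a section. -/
theorem extDerivOneForm_expUnit_smul (A : ConnectionForm J P) {S : E' → P} {ζ : ℂ} {y : E'}
    (hS : ContMDiffAt 𝓘(ℝ, E') J ∞ S y) (u v : ℂ × E') :
    extDerivOneForm J A.form (expUnit ζ • S y)
        (mfderiv 𝓘(ℝ, ℂ × E') J (fun q : ℂ × E' => expUnit q.1 • S q.2) (ζ, y) u)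
        (mfderiv 𝓘(ℝ, ℂ × E') J (fun q : ℂ × E' => expUnit q.1 • S q.2) (ζ, y) v) =
      fderiv ℝ (pullbackForm J (F := ℂ) A.form S) y u.2 v.2 -
        fderiv ℝ (pullbackForm J (F := ℂ) A.form S) y v.2 u.2 := by
  have hA : ∀ p : P, DifferentiableAt ℝ (formChart J (F := ℂ) A.form p) (extChartAt J p p) :=
    fun p => (contDiffAt_formChart A.contMDiff_form p).differentiableAt (by simp)
  have h1 := extDeriv_pullbackForm (A := A.form) (hπ.contMDiffAt_expUnit_smul (ζ := ζ) hS) (hA _)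
  have h2 := extDeriv_pullbackForm (A := A.form) hS (hA _)
  refine (h1.2 u v).symm.trans ?_
  -- The summand `dζ` is constant, so it does not contribute to the derivative.
  have hev : pullbackForm J (F := ℂ) A.form (fun q : ℂ × E' => expUnit q.1 • S q.2)
      =ᶠ[𝓝 (ζ, y)] fun q => .fst ℝ ℂ E' +
        (pullbackForm J (F := ℂ) A.form S q.2).comp (.snd ℝ ℂ E') := by
    have : Filter.Tendsto (fun q : ℂ × E' => q.2) (𝓝 (ζ, y)) (𝓝 y) := continuousAt_snd
    filter_upwards [this.eventually hS.eventually_mdifferentiableAt] with q hq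
    exact ContinuousLinearMap.ext fun r => hπ.pullbackForm_expUnit_smul A hq r.1 r.2
  have hd : HasFDerivAt (fun q : ℂ × E' => ContinuousLinearMap.fst ℝ ℂ E' +
        (pullbackForm J (F := ℂ) A.form S q.2).comp (.snd ℝ ℂ E'))
      ((((ContinuousLinearMap.compL ℝ (ℂ × E') E' ℂ).flip (.snd ℝ ℂ E')).comp
        (fderiv ℝ (pullbackForm J (F := ℂ) A.form S) y)).comp (.snd ℝ ℂ E')) (ζ, y) :=
    HasFDerivAt.const_add _ (((ContinuousLinearMap.compL ℝ (ℂ × E') E' ℂ).flip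
      (.snd ℝ ℂ E')).hasFDerivAt.comp (ζ, y) (HasFDerivAt.comp (ζ, y)
        (g := pullbackForm J (F := ℂ) A.form S) h2.1.hasFDerivAt hasFDerivAt_snd))
  rw [hev.fderiv_eq, hd.fderiv]
  rfl

/-- A point of a principal bundle and its tangent vectors in terms of a local section. -/
theorem exists_expUnit_smul_section {U : Set M} {s : M → P} {τ : P → ℂˣ} {p : P} (hU : IsOpen U)
    (hp : π p ∈ U) (hs : ContMDiffOn I J ∞ s U) (hτ : ContMDiffOn J 𝓘(ℝ, ℂ) ∞ τ (π ⁻¹' U))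
    (hsτ : ∀ p ∈ π ⁻¹' U, τ p • s (π p) = p) :
    ∃ ζ : ℂ, expUnit ζ • s ((extChartAt I (π p)).symm (extChartAt I (π p) (π p))) = p ∧
      ∀ u : EP, ∃ w : ℂ, (mfderiv 𝓘(ℝ, ℂ × EM) J
        (fun q : ℂ × EM => expUnit q.1 • s ((extChartAt I (π p)).symm q.2))
        (ζ, extChartAt I (π p) (π p)) (w, (mfderiv J I π p u : EM)) : EP) = u := by
  set χ := extChartAt I (π p) with hχ
  have hUp : π ⁻¹' U ∈ 𝓝 p := (hU.preimage hπ.contMDiff_proj.continuous).mem_nhds hp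
  have hτp : ContMDiffAt J 𝓘(ℝ, ℂ) ∞ τ p := hτ.contMDiffAt hUp
  have hπp : MDifferentiableAt J I π p := (hπ.contMDiff_proj p).mdifferentiableAt (by simp)
  have hχp : MDifferentiableAt I 𝓘(ℝ, EM) χ (π p) :=
    (contMDiffAt_extChartAt (I := I) (n := ∞)).mdifferentiableAt (by simp)
  -- A logarithm of `τ` smooth near `p`, wherever `τ p` lies: the quotient `τ q / τ p` equals `1` at
  -- `q = p`, away from the branch cut.
  let L : P → ℂ := fun q => Complex.log (τ p : ℂ) + Complex.log ((τ q * (τ p)⁻¹ : ℂˣ) : ℂ)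
  have hexp : ∀ q, expUnit (L q) = τ q := fun q => by
    rw [expUnit_add, expUnit_log, expUnit_log, mul_comm, inv_mul_cancel_right]
  have hL : ContMDiffAt J 𝓘(ℝ, ℂ) ∞ L p := by
    have h1 : ContMDiffAt J 𝓘(ℝ, ℂ) ∞ (fun q => ((τ q * (τ p)⁻¹ : ℂˣ) : ℂ)) p :=
      (Units.contMDiff_val (𝕜 := ℝ) _).comp p (hτp.mul contMDiffAt_const)
    have h2 : ContDiffAt ℝ ∞ (fun z => Complex.log (τ p : ℂ) + Complex.log z)
        ((τ p * (τ p)⁻¹ : ℂˣ) : ℂ) := by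
      refine contDiffAt_const.add ?_
      rw [mul_inv_cancel, Units.val_one]
      exact (Complex.contDiffAt_log (n := ∞) Complex.one_mem_slitPlane).restrict_scalars ℝ
    exact ContDiffAt.comp_contMDiffAt (f := fun q => ((τ q * (τ p)⁻¹ : ℂˣ) : ℂ)) h2 h1
  let Ψ : P → ℂ × EM := fun q => (L q, χ (π q))
  have hΨ : MDifferentiableAt J 𝓘(ℝ, ℂ × EM) Ψ p :=
    (hL.mdifferentiableAt (by simp)).prodMk_space (hχp.comp p hπp)
  set S : EM → P := fun y => s (χ.symm y) with hS
  have hSd : MDifferentiableAt 𝓘(ℝ, EM) J S (χ (π p)) := by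
    have h1 : MDifferentiableAt I J s (π p) :=
      (hs.contMDiffAt (hU.mem_nhds hp)).mdifferentiableAt (by simp)
    exact MDifferentiableAt.comp_of_eq (I := 𝓘(ℝ, EM)) (x := χ (π p)) h1
      (mdifferentiableAt_extChartAt_symm (I := I) (mem_extChartAt_target (π p)))
      (extChartAt_symm_self (π p))
  have hΦ := hπ.mdifferentiableAt_expUnit_smul (ζ := L p) hSd
  set Φ : ℂ × EM → P := fun q => expUnit q.1 • S q.2 with hΦdef
  -- Since `Ψ` is a local right inverse of `Φ`, every `u` is the image under the derivative of `Φ`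
  -- of that of `Ψ` applied to `u`, whose `EM`-component is the projection of `u`.
  have hΦΨ : Φ ∘ Ψ =ᶠ[𝓝 p] id := by
    have : ∀ᶠ q in 𝓝 p, π q ∈ χ.source :=
      hπ.contMDiff_proj.continuous.continuousAt (extChartAt_source_mem_nhds (I := I) (π p))
    filter_upwards [this, hUp] with q hq hqU
    simp only [Function.comp_apply, hΦdef, Ψ, hS, hexp, χ.left_inv hq, id_eq]
    exact hsτ q hqU
  refine ⟨L p, hΦΨ.self_of_nhds, fun u => ⟨(mfderiv J 𝓘(ℝ, ℂ × EM) Ψ p u : ℂ × EM).1, ?_⟩⟩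
  have hsnd : (mfderiv J 𝓘(ℝ, ℂ × EM) Ψ p u : ℂ × EM).2 = (mfderiv J I π p u : EM) := by
    have hsd : MDifferentiableAt 𝓘(ℝ, ℂ × EM) 𝓘(ℝ, EM) (Prod.snd : ℂ × EM → EM) (Ψ p) := by
      rw [mdifferentiableAt_iff_differentiableAt]; fun_prop
    have h1 := mfderiv_comp p hsd hΨ
    have h2 := mfderiv_comp p hχp hπp
    rw [mfderiv_eq_fderiv, fderiv_snd] at h1
    exact (DFunLike.congr_fun h1 u).symm.trans ((DFunLike.congr_fun h2 u).trans
      (mfderiv_extChartAt_self_apply (I := I) (π p) _))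
  have h3 := mfderiv_comp p hΦ hΨ
  have h4 := hΦΨ.mfderiv_eq (I := J) (I' := J)
  rw [← hsnd]
  exact (DFunLike.congr_fun h3 u).symm.trans ((DFunLike.congr_fun h4 u).trans
    (DFunLike.congr_fun (mfderiv_id (I := J) (x := p)) u))

end IsPrincipalCStarBundle

end PrincipalBundle

/-! ### Curvature and descent along the projection -/

section Curvature

variable {EM : Type*} [NormedAddCommGroup EM] [NormedSpace ℝ EM]
  {HM : Type*} [TopologicalSpace HM] {I : ModelWithCorners ℝ EM HM} [I.Boundaryless]
  {M : Type*} [TopologicalSpace M] [ChartedSpace HM M] [IsManifold I ∞ M]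
  {EP : Type*} [NormedAddCommGroup EP] [NormedSpace ℝ EP]
  {HP : Type*} [TopologicalSpace HP] {J : ModelWithCorners ℝ EP HP} [J.Boundaryless]
  {P : Type*} [TopologicalSpace P] [ChartedSpace HP P] [IsManifold J ∞ P] [MulAction ℂˣ P]
  {π : P → M}

theorem extDerivOneForm_congr_base (A : ∀ p : P, TangentSpace J p →L[ℝ] ℂ) {p q : P} (h : p = q)
    (u v : EP) : extDerivOneForm J A p u v = extDerivOneForm J A q u v := by
  subst h; rfl

namespace IsPrincipalCStarBundle

variable (hπ : IsPrincipalCStarBundle I J π)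
include hπ

/-- At `x` the curvature is the antisymmetrized derivative of `s^*A`, with a section `s` chosen
separately for each `x`. No gluing is needed, because the condition at `p` involves only the section
chosen at `π p`. -/
theorem exists_isCurvature (A : ConnectionForm J P) :
    ∃ F : ∀ x : M, TangentSpace I x →L[ℝ] TangentSpace I x →L[ℝ] ℂ, IsCurvature I J π A F := by
  choose U s τ hU hx hs hτ h1 h2 using hπ.exists_localSection
  let D : M → EM →L[ℝ] EM →L[ℝ] ℂ := fun x =>
    fderiv ℝ (pullbackForm J (F := ℂ) A.form (fun y => s x ((extChartAt I x).symm y)))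
      (extChartAt I x x)
  refine ⟨fun x => (D x - (D x).flip : EM →L[ℝ] EM →L[ℝ] ℂ), fun p u v => ?_⟩
  obtain ⟨ζ, hζ, hu⟩ := hπ.exists_expUnit_smul_section (hU (π p)) (hx (π p)) (hs (π p))
    (hτ (π p)) (h2 (π p))
  obtain ⟨w₁, hw₁⟩ := hu u
  obtain ⟨w₂, hw₂⟩ := hu v
  have hS : ContMDiffAt 𝓘(ℝ, EM) J ∞ (fun y => s (π p) ((extChartAt I (π p)).symm y))
      (extChartAt I (π p) (π p)) :=
    ContMDiffAt.comp_of_eq ((hs (π p)).contMDiffAt ((hU (π p)).mem_nhds (hx (π p))))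
      (contMDiffAt_extChartAt_symm (I := I) (mem_extChartAt_target (π p)))
      (extChartAt_symm_self (π p))
  have h3 := hπ.extDerivOneForm_expUnit_smul A (ζ := ζ) hS (w₁, (mfderiv J I π p u : EM))
    (w₂, (mfderiv J I π p v : EM))
  have h4 := extDerivOneForm_congr_base (J := J) A.form hζ u v
  refine Eq.trans ?_ h4
  refine Eq.trans h3.symm ?_
  exact congrArg₂ (extDerivOneForm J A.form _) hw₁ hw₂

theorem isCurvature_unique {A : ConnectionForm J P}
    {F F' : ∀ x : M, TangentSpace I x →L[ℝ] TangentSpace I x →L[ℝ] ℂ}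
    (h : IsCurvature I J π A F) (h' : IsCurvature I J π A F') : F = F' := by
  funext x
  obtain ⟨p, rfl, hp⟩ := hπ.exists_surjective_mfderiv x
  refine ContinuousLinearMap.ext fun u => ContinuousLinearMap.ext fun v => ?_
  obtain ⟨u', rfl⟩ := hp u
  obtain ⟨v', rfl⟩ := hp v
  exact (h p u' v').trans (h' p u' v').symm

/-- Tangent vectors in the kernel of the projection are vertical. -/
theorem eq_vertField (A : ConnectionForm J P) {p : P} {u : TangentSpace J p}
    (hu : (mfderiv J I π p u : EM) = 0) : vertField J (A.form p u) p = u := by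
  obtain ⟨U, s, τ, hU, hx, hs, hτ, h1, h2⟩ := hπ.exists_localSection (π p)
  obtain ⟨ζ, hζ, hz⟩ := hπ.exists_expUnit_smul_section hU hx hs hτ h2
  obtain ⟨w, hw⟩ := hz u
  have hS : ContMDiffAt 𝓘(ℝ, EM) J ∞ (fun y => s ((extChartAt I (π p)).symm y))
      (extChartAt I (π p) (π p)) :=
    ContMDiffAt.comp_of_eq (hs.contMDiffAt (hU.mem_nhds hx))
      (contMDiffAt_extChartAt_symm (I := I) (mem_extChartAt_target (π p)))
      (extChartAt_symm_self (π p))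
  -- The `M`-component of `u` vanishes, so in the coordinates `u` is `(w, 0)`, a vertical vector.
  rw [hu] at hw
  have h3 := hπ.mfderiv_expUnit_smul_vert (ζ := ζ) (hS.mdifferentiableAt (by simp)) w
  have h4 : ∀ q, q = p → (vertField J w q : EP) = vertField J w p := by rintro q rfl; rfl
  have h5 : vertField J w p = u := (h4 _ hζ).symm.trans (h3.symm.trans hw)
  rw [← h5, A.form_vertField]

/-- Smooth functions on the total space which are invariant along the fibres descend. -/
theorem exists_contMDiffMap_comp_proj {f : P → ℂ} (hf : ContMDiff J 𝓘(ℝ, ℂ) ∞ f)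
    (hinv : ∀ (z : ℂˣ) (p : P), f (z • p) = f p) :
    ∃ g : C^∞⟮I, M; 𝓘(ℝ, ℂ), ℂ⟯, ∀ p, g (π p) = f p := by
  have hfib : ∀ p q, π p = π q → f p = f q := by
    intro p q h
    obtain ⟨U, s, τ, -, hx, -, -, -, h2⟩ := hπ.exists_localSection (π p)
    have hp := h2 p hx
    have hq := h2 q (by rw [mem_preimage, ← h]; exact hx)
    rw [← hp, ← hq, hinv, hinv, h]
  -- `r` is an arbitrary set-theoretic section. Near each point `f ∘ r` agrees with `f ∘ s` for a
  -- smooth local section `s`, since `f` is constant on fibres.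
  choose r hr using hπ.surjective_proj
  refine ⟨⟨fun x => f (r x), fun x => ?_⟩, fun p => hfib _ _ (hr _)⟩
  obtain ⟨U, s, τ, hU, hx, hs, -, h1, -⟩ := hπ.exists_localSection x
  have h3 : ContMDiffAt I 𝓘(ℝ, ℂ) ∞ (fun y => f (s y)) x :=
    (hf (s x)).comp x (hs.contMDiffAt (hU.mem_nhds hx))
  refine h3.congr_of_eventuallyEq ?_
  filter_upwards [hU.mem_nhds hx] with y hy
  exact hfib _ _ ((hr y).trans (h1 y hy).symm)

end IsPrincipalCStarBundle

end Curvature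

/-! ### Smoothness of contractions; uniqueness of mixed derivatives -/

section Smoothness

variable {EG : Type*} [NormedAddCommGroup EG] [NormedSpace ℝ EG]
  {HG : Type*} [TopologicalSpace HG] {IG : ModelWithCorners ℝ EG HG} [IG.Boundaryless]
  {G : Type*} [TopologicalSpace G] [ChartedSpace HG G] [Group G] [IsManifold IG ∞ G]
  {E : Type*} [NormedAddCommGroup E] [NormedSpace ℝ E]
  {H : Type*} [TopologicalSpace H] {I : ModelWithCorners ℝ E H} [I.Boundaryless]
  {N : Type*} [TopologicalSpace N] [ChartedSpace H N] [IsManifold I ∞ N]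

theorem contMDiffAt_of_eventuallyEq_chart {F : Type*} [NormedAddCommGroup F] [NormedSpace ℝ F]
    {f : N → F} {g : E → F} {p : N} (hg : ContDiffAt ℝ ∞ g (extChartAt I p p))
    (h : (fun y => f ((extChartAt I p).symm y)) =ᶠ[𝓝 (extChartAt I p p)] g) :
    ContMDiffAt I 𝓘(ℝ, F) ∞ f p := by
  have h1 : ContMDiffAt I 𝓘(ℝ, F) ∞ (fun x => g (extChartAt I p x)) p :=
    ContDiffAt.comp_contMDiffAt hg contMDiffAt_extChartAt
  refine h1.congr_of_eventuallyEq ?_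
  filter_upwards [(continuousAt_extChartAt (I := I) p).eventually h,
    extChartAt_source_mem_nhds (I := I) p] with x hx hs
  rw [← hx, (extChartAt I p).left_inv hs]

variable {V W : ∀ x : N, TangentSpace I x}
  {A : ∀ x : N, TangentSpace I x →L[ℝ] ℂ}

theorem contMDiff_form_apply
    (hA : ∀ p, ContDiffAt ℝ ∞ (formChart I A p) (extChartAt I p p))
    (hV : ∀ p, ContDiffAt ℝ ∞ (vfChart I V p) (extChartAt I p p)) :
    ContMDiff I 𝓘(ℝ, ℂ) ∞ (fun p => A p (V p)) := fun p => by
  refine contMDiffAt_of_eventuallyEq_chart ((hA p).clm_apply (hV p)) ?_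
  filter_upwards [eventually_mem_extChartAt_target (I := I) p] with y hy
  exact (formChart_vfChart A V hy).symm

theorem contMDiff_dirDeriv {f : N → ℂ} (hf : ContMDiff I 𝓘(ℝ, ℂ) ∞ f)
    (hV : ∀ p, ContDiffAt ℝ ∞ (vfChart I V p) (extChartAt I p p)) :
    ContMDiff I 𝓘(ℝ, ℂ) ∞ (fun p => dirDeriv I f p (V p)) := fun p => by
  have h1 : ContDiffAt ℝ ∞ (fun y => f ((extChartAt I p).symm y)) (extChartAt I p p) :=
    (ContMDiffAt.comp (extChartAt I p p) (hf _)
      (contMDiffAt_extChartAt_symm (I := I) (mem_extChartAt_target p))).contDiffAt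
  refine contMDiffAt_of_eventuallyEq_chart (h1.contDiffAt_fderiv_infty.clm_apply (hV p)) ?_
  filter_upwards [eventually_mem_extChartAt_target (I := I) p] with y hy
  have h2 := mfderiv_comp y ((hf ((extChartAt I p).symm y)).mdifferentiableAt (by simp))
    (mdifferentiableAt_extChartAt_symm hy)
  rw [mfderiv_eq_fderiv] at h2
  refine Eq.symm ((DFunLike.congr_fun h2 (vfChart I V p y)).trans ?_)
  exact congrArg (mfderiv I 𝓘(ℝ, ℂ) f ((extChartAt I p).symm y))
    (mfderiv_symm_mfderiv_extChartAt hy (V ((extChartAt I p).symm y)))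

/-- `extDerivOneForm` uses a different chart at every point, so its smoothness is not immediate.
Naturality under the inverse chart at `p` expresses all nearby values in that single chart. -/
theorem contMDiff_extDerivOneForm_apply
    (hA : ∀ p, ContDiffAt ℝ ∞ (formChart I A p) (extChartAt I p p))
    (hV : ∀ p, ContDiffAt ℝ ∞ (vfChart I V p) (extChartAt I p p))
    (hW : ∀ p, ContDiffAt ℝ ∞ (vfChart I W p) (extChartAt I p p)) :
    ContMDiff I 𝓘(ℝ, ℂ) ∞ (fun p => extDerivOneForm I A p (V p) (W p)) := fun p => by
  have hD := (hA p).contDiffAt_fderiv_infty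
  refine contMDiffAt_of_eventuallyEq_chart (((hD.clm_apply (hV p)).clm_apply (hW p)).sub
    ((hD.clm_apply (hW p)).clm_apply (hV p))) ?_
  filter_upwards [eventually_mem_extChartAt_target (I := I) p] with y hy
  have h1 := (extDeriv_pullbackForm (A := A) (contMDiffAt_extChartAt_symm hy)
    ((hA _).differentiableAt (by simp))).2 (vfChart I V p y) (vfChart I W p y)
  refine Eq.symm (h1.trans ?_)
  exact congrArg₂ (extDerivOneForm I A ((extChartAt I p).symm y))
    (mfderiv_symm_mfderiv_extChartAt hy (V ((extChartAt I p).symm y)))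
    (mfderiv_symm_mfderiv_extChartAt hy (W ((extChartAt I p).symm y)))

/-- Mixed derivatives are unique. -/
theorem HasMixedDeriv.unique {u : ℝ → ℝ → N} {p : N} {v v' : TangentSpace I p}
    (h : HasMixedDeriv I u p v) (h' : HasMixedDeriv I u p v') : v = v' := by
  obtain ⟨w, hw, hv⟩ := h
  obtain ⟨w', hw', hv'⟩ := h'
  have : w =ᶠ[𝓝 0] w' := by
    filter_upwards [hw, hw'] with s h1 h2 using h1.unique h2
  exact hv.unique (hv'.congr_of_eventuallyEq this)

end Smoothness

/-! ### The lifted fields and the cocycle -/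

section Extension

open VectorField

variable {EG : Type*} [NormedAddCommGroup EG] [NormedSpace ℝ EG]
  {HG : Type*} [TopologicalSpace HG] {IG : ModelWithCorners ℝ EG HG} [IG.Boundaryless]
  {G : Type*} [TopologicalSpace G] [ChartedSpace HG G] [Group G] [LieGroup IG ∞ G]
  {EM : Type*} [NormedAddCommGroup EM] [NormedSpace ℝ EM]
  {HM : Type*} [TopologicalSpace HM] {I : ModelWithCorners ℝ EM HM} [I.Boundaryless]
  {M : Type*} [TopologicalSpace M] [ChartedSpace HM M] [IsManifold I ∞ M] [MulAction Gᵐᵒᵖ M]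
  {EP : Type*} [NormedAddCommGroup EP] [NormedSpace ℝ EP]
  {HP : Type*} [TopologicalSpace HP] {J : ModelWithCorners ℝ EP HP} [J.Boundaryless]
  {P : Type*} [TopologicalSpace P] [ChartedSpace HP P] [IsManifold J ∞ P] [MulAction ℂˣ P]
  {π : P → M}

namespace LocalSection

/-- The local right action `p ↦ p σ(g)` on the total space defined by a local section. -/
noncomputable def act (σ : LocalSection IG G J π) (p : P) (g : G) : P := (σ.toFun g).diffeo p

variable (σ : LocalSection IG G J π)

theorem act_one (p : P) : σ.act p 1 = p := by
  unfold act
  rw [σ.map_one]; rfl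

theorem contMDiffAt_act (p : P) :
    ContMDiffAt (J.prod IG) J ∞ (fun q : P × G => σ.act q.1 q.2) (p, 1) :=
  σ.contMDiffOn.contMDiffAt ((isOpen_univ.prod σ.isOpen_dom).mem_nhds ⟨mem_univ _, σ.one_mem_dom⟩)

theorem field_add (ξ η : GroupLieAlgebra IG G) (p : P) :
    σ.field (ξ + η) p = σ.field ξ p + σ.field η p :=
  orbitField_add (I := J) (a := σ.act) ξ η p

theorem field_smul (c : ℝ) (ξ : GroupLieAlgebra IG G) (p : P) :
    σ.field (c • ξ) p = c • σ.field ξ p :=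
  orbitField_smul (I := J) (a := σ.act) c ξ p

theorem contDiffAt_vfChart_field (ξ : GroupLieAlgebra IG G) (p : P) :
    ContDiffAt ℝ ∞ (vfChart J (σ.field ξ) p) (extChartAt J p p) := by
  have : IsManifold IG ∞ G := inferInstance
  exact contDiffAt_vfChart_orbitField σ.act_one σ.contMDiffAt_act p ξ

theorem mdifferentiableAt_act (p : P) : MDifferentiableAt IG J (σ.act p) 1 := by
  have : IsManifold IG ∞ G := inferInstance
  exact mdifferentiableAt_orbitMap σ.act_one σ.contMDiffAt_act p

/-- Differentiate `π (p σ(g)) = π(p) g`, which is valid for `g` in the neighbourhood `σ.dom` of `1`.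
-/
theorem mfderiv_proj_field (hπ : IsPrincipalCStarBundle I J π) (ξ : GroupLieAlgebra IG G) (p : P) :
    mfderiv J I π p (σ.field ξ p) = fundField I ξ (π p) := by
  have h1 := mfderiv_comp (1 : G) ((hπ.contMDiff_proj (σ.act p 1)).mdifferentiableAt (by simp))
    (σ.mdifferentiableAt_act p)
  have hev : π ∘ σ.act p =ᶠ[𝓝 1] fun g : G => π p <• g := by
    filter_upwards [σ.isOpen_dom.mem_nhds σ.one_mem_dom] with g hg
    have := (σ.toFun g).covers p
    rw [σ.base_toFun g hg] at this
    exact this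
  have h2 := hev.mfderiv_eq (I := IG) (I' := I)
  exact (mfderiv_congr_base π (σ.act_one p).symm _).trans
    ((DFunLike.congr_fun h1 ξ).symm.trans (DFunLike.congr_fun h2 ξ))

theorem field_const_smul (hπ : IsPrincipalCStarBundle I J π) (ξ : GroupLieAlgebra IG G) (z : ℂˣ)
    (p : P) : σ.field ξ (z • p) = mfderiv J J (fun q : P => z • q) p (σ.field ξ p) := by
  have h1 := mfderiv_comp (1 : G)
    ((hπ.contMDiff_const_smul z (σ.act p 1)).mdifferentiableAt (by simp))
    (σ.mdifferentiableAt_act p)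
  have h2 : (fun q : P => z • q) ∘ σ.act p = σ.act (z • p) := by
    ext g; exact ((σ.toFun g).equivariant z p).symm
  rw [h2] at h1
  exact (DFunLike.congr_fun h1 ξ).trans (mfderiv_congr_base _ (σ.act_one p) _)

theorem form_field_const_smul (hπ : IsPrincipalCStarBundle I J π) (A : ConnectionForm J P)
    (ξ : GroupLieAlgebra IG G) (z : ℂˣ) (p : P) :
    A.form (z • p) (σ.field ξ (z • p)) = A.form p (σ.field ξ p) := by
  rw [σ.field_const_smul hπ, A.form_smul]

theorem contMDiff_form_field (A : ConnectionForm J P) (ξ : GroupLieAlgebra IG G) :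
    ContMDiff J 𝓘(ℝ, ℂ) ∞ (fun p => (A.form p (σ.field ξ p) : ℂ)) :=
  contMDiff_form_apply (A := A.form) (contDiffAt_formChart A.contMDiff_form)
    (σ.contDiffAt_vfChart_field ξ)

/-- `A` and the lifted fields are both `ℂˣ`-invariant, so their pairing descends. Linearity in `ξ`
can be tested on `P`, as `π` is surjective. -/
theorem exists_isConnectionCochain (hπ : IsPrincipalCStarBundle I J π) (A : ConnectionForm J P) :
    ∃ b : GroupLieAlgebra IG G →ₗ[ℝ] C^∞⟮I, M; 𝓘(ℝ, ℂ), ℂ⟯, σ.IsConnectionCochain A b := by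
  choose b hb using fun ξ : GroupLieAlgebra IG G => hπ.exists_contMDiffMap_comp_proj
    (σ.contMDiff_form_field A ξ) (σ.form_field_const_smul hπ A ξ)
  refine ⟨{ toFun := b, map_add' := fun ξ η => ?_, map_smul' := fun c ξ => ?_ }, hb⟩
  · ext x
    obtain ⟨p, rfl⟩ := hπ.surjective_proj x
    rw [ContMDiffMap.coe_add, Pi.add_apply, hb, hb, hb, σ.field_add]
    exact (A.form p).map_add _ _
  · ext x
    obtain ⟨p, rfl⟩ := hπ.surjective_proj x
    rw [RingHom.id_apply, ContMDiffMap.coe_smul, Pi.smul_apply, hb, hb, σ.field_smul]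
    exact (A.form p).map_smul _ _

theorem isConnectionCochain_unique (hπ : IsPrincipalCStarBundle I J π) {A : ConnectionForm J P}
    {b b' : GroupLieAlgebra IG G →ₗ[ℝ] C^∞⟮I, M; 𝓘(ℝ, ℂ), ℂ⟯}
    (h : σ.IsConnectionCochain A b) (h' : σ.IsConnectionCochain A b') : b = b' := by
  ext ξ x
  obtain ⟨p, rfl⟩ := hπ.surjective_proj x
  exact (h ξ p).trans (h' ξ p).symm

variable [CompleteSpace EG] [T2Space G]

/-- The commutator of the lifted one-parameter subgroups, computed through the Lie bracket of the
vector fields on the total space. -/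
theorem hasMixedDeriv_mlieBracket (ξ η : GroupLieAlgebra IG G) (p : P) :
    HasMixedDeriv J
      (fun t s => (σ.toFun (expCurve ξ t) * σ.toFun (expCurve η s) *
        σ.toFun (expCurve ξ (-t)) * σ.toFun (expCurve η (-s))).diffeo p)
      p (mlieBracket J (σ.field ξ) (σ.field η) p) := by
  have : IsManifold IG ∞ G := inferInstance
  exact hasMixedDeriv_commutator σ.act_one σ.contMDiffAt_act p (expCurve_zero ξ) (expCurve_zero η)
    (continuousAt_expCurve ξ 0) (continuousAt_expCurve η 0) (hasDerivAt_extChartAt_expCurve ξ)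
    (hasDerivAt_extChartAt_expCurve η)

variable (hact : ContMDiff (I.prod IG) I ∞ (fun q : M × G => q.1 <• q.2))
  (hπ : IsPrincipalCStarBundle I J π)
include hact hπ

/-- Brackets of `π`-related fields are `π`-related, and on `M` the genuine action of `G` identifies
the bracket. On `P` the same identification may fail, as `σ` need not be multiplicative; the
vertical defect is the cocycle. -/
theorem mfderiv_proj_mlieBracket (ξ η : GroupLieAlgebra IG G) (p : P) :
    mfderiv J I π p (mlieBracket J (σ.field ξ) (σ.field η) p) = fundField I ⁅ξ, η⁆ (π p) := by
  have : IsManifold IG ∞ G := inferInstance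
  have h1 : ∀ x : M, x <• (1 : G) = x := fun x => by simp
  have hd : ∀ (ξ : GroupLieAlgebra IG G) (x : M), DifferentiableAt ℝ
      (vfChart I (orbitField I (fun (x : M) (g : G) => x <• g) ξ) x) (extChartAt I x x) :=
    fun ξ x => differentiableAt_vfChart_orbitField h1 (fun y => hact (y, 1)) x ξ
  have h2 := mfderiv_mlieBracket_of_related hπ.contMDiff_proj p
    ((σ.contDiffAt_vfChart_field ξ p).differentiableAt (by simp))
    ((σ.contDiffAt_vfChart_field η p).differentiableAt (by simp))
    (hd ξ (π p)) (hd η (π p)) (fun q => σ.mfderiv_proj_field hπ ξ q)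
    (fun q => σ.mfderiv_proj_field hπ η q)
  refine h2.trans (mlieBracket_orbitField h1 (fun x g h => ?_) hact ξ η (π p))
  rw [smul_smul, MulOpposite.op_mul]

theorem dirDeriv_form_field {A : ConnectionForm J P}
    {b : GroupLieAlgebra IG G →ₗ[ℝ] C^∞⟮I, M; 𝓘(ℝ, ℂ), ℂ⟯} (hb : σ.IsConnectionCochain A b)
    (ξ η : GroupLieAlgebra IG G) (p : P) :
    dirDeriv J (fun q => (A.form q (σ.field η q) : ℂ)) p (σ.field ξ p) =
      lieAct ξ (b η) (π p) := by
  have hf : MDifferentiableAt I 𝓘(ℝ, ℂ) (b η) (π p) :=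
    ((b η).contMDiff (π p)).mdifferentiableAt (by simp)
  have h1 : (fun q => (A.form q (σ.field η q) : ℂ)) = b η ∘ π := funext fun q => (hb η q).symm
  rw [h1, lieAct_eq_dirDeriv hact hf]
  refine (DFunLike.congr_fun (mfderiv_comp p hf
    ((hπ.contMDiff_proj p).mdifferentiableAt (by simp))) _).trans ?_
  exact congrArg (dirDeriv I (b η) (π p)) (σ.mfderiv_proj_field hπ ξ p)

/-- The mixed derivative which defines the cocycle of a local section, in terms of the curvature
and the cochain of a connection. -/
theorem hasMixedDeriv_curvature {A : ConnectionForm J P}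
    {F : ∀ x : M, TangentSpace I x →L[ℝ] TangentSpace I x →L[ℝ] ℂ}
    {b : GroupLieAlgebra IG G →ₗ[ℝ] C^∞⟮I, M; 𝓘(ℝ, ℂ), ℂ⟯}
    (hF : IsCurvature I J π A F) (hb : σ.IsConnectionCochain A b)
    (ξ η : GroupLieAlgebra IG G) (p : P) :
    HasMixedDeriv J
      (fun t s => (σ.toFun (expCurve ξ t) * σ.toFun (expCurve η s) *
        σ.toFun (expCurve ξ (-t)) * σ.toFun (expCurve η (-s))).diffeo p)
      p (σ.field ⁅ξ, η⁆ p + vertField J (-F (π p) (fundField I ξ (π p)) (fundField I η (π p))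
          + lieAct ξ (b η) (π p) - lieAct η (b ξ) (π p) - b ⁅ξ, η⁆ (π p)) p) := by
  have h1 := σ.hasMixedDeriv_mlieBracket ξ η p
  set v := mlieBracket J (σ.field ξ) (σ.field η) p with hv
  -- Cartan's formula, with `dA` replaced by the pullback of `F` and the derivatives of `A` on the
  -- lifted fields by derivatives of `b` on `M`.
  have hAv : (A.form p v : ℂ) = lieAct ξ (b η) (π p) - lieAct η (b ξ) (π p) -
      F (π p) (fundField I ξ (π p)) (fundField I η (π p)) := by
    have h2 := form_mlieBracket (A := A.form) (p := p)
      ((contDiffAt_formChart A.contMDiff_form p).differentiableAt (by simp))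
      ((σ.contDiffAt_vfChart_field ξ p).differentiableAt (by simp))
      ((σ.contDiffAt_vfChart_field η p).differentiableAt (by simp))
      ((σ.contMDiff_form_field A ξ p).mdifferentiableAt (by simp))
      ((σ.contMDiff_form_field A η p).mdifferentiableAt (by simp))
    refine h2.trans ?_
    rw [← hF p, σ.mfderiv_proj_field hπ, σ.mfderiv_proj_field hπ]
    exact congrArg₂ (fun x y => x - y - F (π p) (fundField I ξ (π p)) (fundField I η (π p)))
      (σ.dirDeriv_form_field hact hπ hb ξ η p) (σ.dirDeriv_form_field hact hπ hb η ξ p)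
  -- Both vectors lie over the fundamental field of `⁅ξ, η⁆`, so the difference is vertical and is
  -- determined by its value under `A`.
  have hker : mfderiv J I π p (v - σ.field ⁅ξ, η⁆ p) = 0 := by
    rw [map_sub, σ.mfderiv_proj_mlieBracket hact hπ, σ.mfderiv_proj_field hπ, sub_self]
  have h3 := hπ.eq_vertField A hker
  have h4 : (A.form p (v - σ.field ⁅ξ, η⁆ p) : ℂ) =
      -F (π p) (fundField I ξ (π p)) (fundField I η (π p))
          + lieAct ξ (b η) (π p) - lieAct η (b ξ) (π p) - b ⁅ξ, η⁆ (π p) := by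
    refine ((A.form p).map_sub _ _).trans ?_
    refine (congrArg₂ (fun x y : ℂ => x - y) hAv (hb ⁅ξ, η⁆ p).symm).trans ?_
    ring
  rw [← h4, show vertField J (A.form p (v - σ.field ⁅ξ, η⁆ p) : ℂ) p = _ from h3,
    add_sub_cancel]
  exact h1

/-- The asserted formula serves as the definition of the cocycle. `IsCurvature` does not include
smoothness of `F`; smoothness of the curvature term is obtained on `P` from `dA` on the lifted
fields and then descends. -/
theorem exists_cocycle_formula (σ : LocalSection IG G J π) {A : ConnectionForm J P}
    {F : ∀ x : M, TangentSpace I x →L[ℝ] TangentSpace I x →L[ℝ] ℂ}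
    (hF : IsCurvature I J π A F) (b : GroupLieAlgebra IG G →ₗ[ℝ] C^∞⟮I, M; 𝓘(ℝ, ℂ), ℂ⟯) :
    ∃ om : GroupLieAlgebra IG G →ₗ[ℝ] GroupLieAlgebra IG G →ₗ[ℝ] C^∞⟮I, M; 𝓘(ℝ, ℂ), ℂ⟯,
      ∀ ξ η x, om ξ η x = -F x (fundField I ξ x) (fundField I η x)
          + lieAct ξ (b η) x - lieAct η (b ξ) x - b ⁅ξ, η⁆ x := by
  have : IsManifold IG ∞ G := inferInstance
  have : LieGroup IG (minSmoothness ℝ 3) G :=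
    LieGroup.of_le (n := ∞) (by simp only [minSmoothness_of_isRCLikeNormedField]; exact ENat.LEInfty.out)
  have hfd : ∀ (f : C^∞⟮I, M; 𝓘(ℝ, ℂ), ℂ⟯) (x : M), MDifferentiableAt I 𝓘(ℝ, ℂ) f x := fun f x =>
    (f.contMDiff x).mdifferentiableAt (by simp)
  have hlie : ∀ (ξ : GroupLieAlgebra IG G) (f : C^∞⟮I, M; 𝓘(ℝ, ℂ), ℂ⟯),
      ContMDiff I 𝓘(ℝ, ℂ) ∞ (lieAct ξ f) := by
    intro ξ f
    have h1 : lieAct ξ f = fun x => dirDeriv I f x (fundField I ξ x) :=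
      funext fun x => lieAct_eq_dirDeriv hact (hfd f x) ξ
    rw [h1]
    exact contMDiff_dirDeriv f.contMDiff fun x => contDiffAt_vfChart_orbitField
      (a := fun (x : M) (g : G) => x <• g) (fun x => by simp) (fun y => hact (y, 1)) x ξ
  have hex : ∀ ξ η : GroupLieAlgebra IG G, ∃ g : C^∞⟮I, M; 𝓘(ℝ, ℂ), ℂ⟯, ∀ p : P, g (π p) =
      -F (π p) (fundField I ξ (π p)) (fundField I η (π p))
          + lieAct ξ (b η) (π p) - lieAct η (b ξ) (π p) - b ⁅ξ, η⁆ (π p) := by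
    intro ξ η
    have h2 := contMDiff_extDerivOneForm_apply (A := A.form)
      (contDiffAt_formChart A.contMDiff_form)
      (σ.contDiffAt_vfChart_field ξ) (σ.contDiffAt_vfChart_field η)
    have h3 : (fun p => extDerivOneForm J A.form p (σ.field ξ p) (σ.field η p)) = fun p =>
        F (π p) (fundField I ξ (π p)) (fundField I η (π p)) := by
      funext p
      rw [← hF p, σ.mfderiv_proj_field hπ, σ.mfderiv_proj_field hπ]
    rw [h3] at h2
    refine hπ.exists_contMDiffMap_comp_proj (f := fun p =>
      -F (π p) (fundField I ξ (π p)) (fundField I η (π p))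
          + lieAct ξ (b η) (π p) - lieAct η (b ξ) (π p) - b ⁅ξ, η⁆ (π p))
      (((h2.neg.add ((hlie ξ (b η)).comp hπ.contMDiff_proj)).sub
        ((hlie η (b ξ)).comp hπ.contMDiff_proj)).sub
        ((b ⁅ξ, η⁆).contMDiff.comp hπ.contMDiff_proj)) fun z p => ?_
    exact congrArg (fun x => -F x (fundField I ξ x) (fundField I η x)
      + lieAct ξ (b η) x - lieAct η (b ξ) x - b ⁅ξ, η⁆ x) (hπ.proj_smul z p)
  choose om hom using hex
  have hom' : ∀ ξ η x, om ξ η x = -F x (fundField I ξ x) (fundField I η x)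
          + lieAct ξ (b η) x - lieAct η (b ξ) x - b ⁅ξ, η⁆ x := by
    intro ξ η x
    obtain ⟨p, rfl⟩ := hπ.surjective_proj x
    exact hom ξ η p
  have fadd : ∀ (ξ η : GroupLieAlgebra IG G) (x : M),
      fundField I (ξ + η) x = fundField I ξ x + fundField I η x := fun ξ η x =>
    orbitField_add (I := I) (a := fun (x : M) (g : G) => x <• g) ξ η x
  have fsmul : ∀ (c : ℝ) (ξ : GroupLieAlgebra IG G) (x : M),
      fundField I (c • ξ) x = c • fundField I ξ x := fun c ξ x =>
    orbitField_smul (I := I) (a := fun (x : M) (g : G) => x <• g) c ξ x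
  -- The curve `expCurve (ξ + η)` is in general not the product of the two curves; additivity comes
  -- from rewriting `lieAct` as a directional derivative.
  have ladd : ∀ (ξ η : GroupLieAlgebra IG G) (f : C^∞⟮I, M; 𝓘(ℝ, ℂ), ℂ⟯) (x : M),
      lieAct (ξ + η) f x = lieAct ξ f x + lieAct η f x := fun ξ η f x => by
    rw [lieAct_eq_dirDeriv hact (hfd f x), lieAct_eq_dirDeriv hact (hfd f x),
      lieAct_eq_dirDeriv hact (hfd f x), fadd]
    exact (mfderiv I 𝓘(ℝ, ℂ) f x).map_add _ _
  have lsmul : ∀ (c : ℝ) (ξ : GroupLieAlgebra IG G) (f : C^∞⟮I, M; 𝓘(ℝ, ℂ), ℂ⟯) (x : M),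
      lieAct (c • ξ) f x = c • lieAct ξ f x := fun c ξ f x => by
    rw [lieAct_eq_dirDeriv hact (hfd f x), lieAct_eq_dirDeriv hact (hfd f x), fsmul]
    exact (mfderiv I 𝓘(ℝ, ℂ) f x).map_smul _ _
  have laddf : ∀ (ξ : GroupLieAlgebra IG G) (f g : C^∞⟮I, M; 𝓘(ℝ, ℂ), ℂ⟯) (x : M),
      lieAct ξ (⇑(f + g)) x = lieAct ξ f x + lieAct ξ g x := fun ξ f g x => by
    rw [lieAct_eq_dirDeriv hact (hfd _ x), lieAct_eq_dirDeriv hact (hfd f x),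
      lieAct_eq_dirDeriv hact (hfd g x)]
    exact DFunLike.congr_fun (mfderiv_add (hfd f x) (hfd g x)) _
  have lsmulf : ∀ (ξ : GroupLieAlgebra IG G) (c : ℝ) (f : C^∞⟮I, M; 𝓘(ℝ, ℂ), ℂ⟯) (x : M),
      lieAct ξ (⇑(c • f)) x = c • lieAct ξ f x := fun ξ c f x => by
    rw [lieAct_eq_dirDeriv hact (hfd _ x), lieAct_eq_dirDeriv hact (hfd f x)]
    exact DFunLike.congr_fun (const_smul_mfderiv (hfd f x) c) _
  refine ⟨LinearMap.mk₂ ℝ om ?_ ?_ ?_ ?_, fun ξ η x => hom' ξ η x⟩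
  · intro ξ ξ' η
    ext x
    rw [ContMDiffMap.coe_add, Pi.add_apply, hom', hom', hom', map_add, laddf, ladd, add_lie,
      map_add, ContMDiffMap.coe_add, Pi.add_apply, fadd, map_add, add_apply]
    ring
  · intro c ξ η
    ext x
    rw [ContMDiffMap.coe_smul, Pi.smul_apply, hom', hom', map_smul, lsmulf, lsmul, smul_lie,
      map_smul, ContMDiffMap.coe_smul, Pi.smul_apply, fsmul, map_smul, smul_apply]
    simp only [smul_sub, smul_add, smul_neg]
  · intro ξ η η'
    ext x
    rw [ContMDiffMap.coe_add, Pi.add_apply, hom', hom', hom', map_add, laddf, ladd, lie_add,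
      map_add, ContMDiffMap.coe_add, Pi.add_apply, fadd, map_add]
    ring
  · intro c ξ η
    ext x
    rw [ContMDiffMap.coe_smul, Pi.smul_apply, hom', hom', map_smul, lsmulf, lsmul, lie_smul,
      map_smul, ContMDiffMap.coe_smul, Pi.smul_apply, fsmul, map_smul]
    simp only [smul_sub, smul_add, smul_neg]

/-- Mixed derivatives are unique, so two vertical vectors coincide, and `A` recovers their
generators. -/
theorem cocycle_eq {A : ConnectionForm J P}
    {F : ∀ x : M, TangentSpace I x →L[ℝ] TangentSpace I x →L[ℝ] ℂ}
    {b : GroupLieAlgebra IG G →ₗ[ℝ] C^∞⟮I, M; 𝓘(ℝ, ℂ), ℂ⟯}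
    {om : GroupLieAlgebra IG G →ₗ[ℝ] GroupLieAlgebra IG G →ₗ[ℝ] C^∞⟮I, M; 𝓘(ℝ, ℂ), ℂ⟯}
    (hF : IsCurvature I J π A F) (hb : σ.IsConnectionCochain A b) (hom : σ.IsSectionCocycle om)
    (ξ η : GroupLieAlgebra IG G) (x : M) :
    om ξ η x = -F x (fundField I ξ x) (fundField I η x)
          + lieAct ξ (b η) x - lieAct η (b ξ) x - b ⁅ξ, η⁆ x := by
  obtain ⟨p, rfl⟩ := hπ.surjective_proj x
  have h1 := (hom ξ η p).unique (σ.hasMixedDeriv_curvature hact hπ hF hb ξ η p)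
  have h2 := congrArg (A.form p) (add_left_cancel h1)
  rwa [A.form_vertField, A.form_vertField] at h2

end LocalSection

end Extension

/-! ### The main theorem -/

theorem mainTheorem2
    {EG : Type*} [NormedAddCommGroup EG] [NormedSpace ℝ EG] [CompleteSpace EG]
    {HG : Type*} [TopologicalSpace HG] {IG : ModelWithCorners ℝ EG HG} [IG.Boundaryless]
    {G : Type*} [TopologicalSpace G] [T2Space G] [ChartedSpace HG G] [Group G] [LieGroup IG ∞ G]
    {EM : Type*} [NormedAddCommGroup EM] [NormedSpace ℝ EM] [CompleteSpace EM]
    {HM : Type*} [TopologicalSpace HM] {I : ModelWithCorners ℝ EM HM} [I.Boundaryless]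
    {M : Type*} [TopologicalSpace M] [T2Space M] [ChartedSpace HM M] [IsManifold I ∞ M]
    [MulAction Gᵐᵒᵖ M]
    {EP : Type*} [NormedAddCommGroup EP] [NormedSpace ℝ EP] [CompleteSpace EP]
    {HP : Type*} [TopologicalSpace HP] {J : ModelWithCorners ℝ EP HP} [J.Boundaryless]
    {P : Type*} [TopologicalSpace P] [T2Space P] [ChartedSpace HP P] [IsManifold J ∞ P]
    [MulAction ℂˣ P]
    (hact : ContMDiff (I.prod IG) I ∞ (fun q : M × G => q.1 <• q.2))
    (π : P → M) (hπ : IsPrincipalCStarBundle I J π)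
    (A : ConnectionForm J P) (σ : LocalSection IG G J π) :
    (∃! F : ∀ x : M, TangentSpace I x →L[ℝ] TangentSpace I x →L[ℝ] ℂ, IsCurvature I J π A F) ∧
    (∃! b : GroupLieAlgebra IG G →ₗ[ℝ] C^∞⟮I, M; 𝓘(ℝ, ℂ), ℂ⟯, σ.IsConnectionCochain A b) ∧
    (∃! om : GroupLieAlgebra IG G →ₗ[ℝ] GroupLieAlgebra IG G →ₗ[ℝ] C^∞⟮I, M; 𝓘(ℝ, ℂ), ℂ⟯,
      σ.IsSectionCocycle om) ∧
    ∀ (F : ∀ x : M, TangentSpace I x →L[ℝ] TangentSpace I x →L[ℝ] ℂ)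
      (b : GroupLieAlgebra IG G →ₗ[ℝ] C^∞⟮I, M; 𝓘(ℝ, ℂ), ℂ⟯)
      (omA : GroupLieAlgebra IG G →ₗ[ℝ] GroupLieAlgebra IG G →ₗ[ℝ] C^∞⟮I, M; 𝓘(ℝ, ℂ), ℂ⟯),
      IsCurvature I J π A F → σ.IsConnectionCochain A b → σ.IsSectionCocycle omA →
      ∀ (ξ η : GroupLieAlgebra IG G) (x : M),
        omA ξ η x = -F x (fundField I ξ x) (fundField I η x)
          + lieAct ξ (b η) x - lieAct η (b ξ) x - b ⁅ξ, η⁆ x := by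
  obtain ⟨F, hF⟩ := hπ.exists_isCurvature A
  obtain ⟨b, hb⟩ := σ.exists_isConnectionCochain hπ A
  obtain ⟨om, hom⟩ := σ.exists_cocycle_formula hact hπ hF b
  refine ⟨⟨F, hF, fun F' hF' => hπ.isCurvature_unique hF' hF⟩,
    ⟨b, hb, fun b' hb' => σ.isConnectionCochain_unique hπ hb' hb⟩,
    ⟨om, fun ξ η p => ?_, fun om' hom' => ?_⟩,
    fun F b omA hF hb hom ξ η x => σ.cocycle_eq hact hπ hF hb hom ξ η x⟩
  · rw [hom]
    exact σ.hasMixedDeriv_curvature hact hπ hF hb ξ η p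
  · ext ξ η x
    rw [hom, σ.cocycle_eq hact hπ hF hb hom']
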